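/- Let $\Xi\subset\mathbb{R}^r$ and let $f:\mathbb{R}^n\times\Xi\to\mathbb{R}$, $h:\mathbb{R}^n\times\Xi\to\mathbb{R}^p$, $g:\mathbb{R}^n\times\Xi\to\mathbb{R}^m$ be twice continuously differentiable in $(x,\xi)$. Consider the parametrized problem of minimizing $f(x,\xi)$ over $x\in\mathbb{R}^n$ subject to $h(x,\xi)=0$, $g(x,\xi)\le 0$, with feasible set $\mathcal{X}(\xi)$ and Lagrangian $L(x,\lambda,\mu,\xi)=f(x,\xi)+\lambda^\top h(x,\xi)+\mu^\top g(x,\xi)$. All norms are Euclidean norms and the induced operator norms. A triple $(x,\lambda,\mu)\in\mathcal{X}(\xi)\times\mathbb{R}^p\times\mathbb{R}^m_{\ge0}$ is a regular minimizer for $\xi$ if: (LICQ) the gradients $\nabla_x h_j(x,\xi)$, $1\le j\le p$, and $\nabla_x g_i(x,\xi)$, $i\in\mathbf{I}:=\{i: g_i(x,\xi)=0\}$, are linearly independent; (KKT) $\nabla_xL(x,\lambda,\mu,\xi)=0$ and $\mu_i=0$ whenever $g_i(x,\xi)<0$; (SSOSC) $y^\top\nabla^2_{xx}L(x,\lambda,\mu,\xi)\,y>0$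 for every $y\ne0$ with $\nabla_xh(x,\xi)y=0$ and $\nabla_xg_i(x,\xi)y=0$ for all $i$ with $\mu_i>0$. Let $\bar\xi$ be an interior point of $\Xi$, let $(\bar x,\bar\lambda,\bar\mu)$ be a regular minimizer for $\bar\xi$ (strict complementarity is not assumed), and assume that $A:=\nabla^2_{xx}L(\bar x,\bar\lambda,\bar\mu,\bar\xi)$ is positive definite. Let $\mathbf{I}:=\{i: g_i(\bar x,\bar\xi)=0\}$ be the set of all active inequality constraints, weakly active ones ($\bar\mu_i=0$) included, and put $$B:=\begin{bmatrix}\nabla_xh(\bar x,\bar\xi)\\ \nabla_xg_{\mathbf{I}}(\bar x,\bar\xi)\end{bmatrix},\qquad G^\star:=\begin{bmatrix}\nabla_\xi h(\bar x,\bar\xi)\\ \nabla_\xi g_{\mathbf{I}}(\bar x,\bar\xi)\end{bmatrix},\qquad L^\star:=\nabla_\xi\big(\nabla_xL\big)^{\top}(\bar x,\bar\lambda,\bar\mu,\bar\xi)\in\mathbb{R}^{n\times r}.$$ Write $\lambda^{\max}_A,\lambda^{\min}_A$ for the extreme eigenvalues of $A$ and $\sigma^{\min}_{B^\top}$ for the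 smallest singular value of $B^\top$, and let $$\ell_{x^\star}:=\sqrt{\frac{\lambda^{\max}_A}{\lambda^{\min}_A}}\left(\frac{\|L^\star\|}{\lambda^{\min}_A}+\frac{\|G^\star\|}{\sigma^{\min}_{B^\top}}\right),\qquad \ell_{(\lambda^\star,\mu^\star)}:=\frac{(\lambda^{\max}_A)^{3/2}}{\sigma^{\min}_{B^\top}(\lambda^{\min}_A)^{1/2}}\left(\frac{\|L^\star\|}{\lambda^{\min}_A}+\frac{\|G^\star\|}{\sigma^{\min}_{B^\top}}\right);$$ if $p=0$ and $\mathbf{I}=\emptyset$, the term $\|G^\star\|/\sigma^{\min}_{B^\top}$ is read as $0$ and $\ell_{(\lambda^\star,\mu^\star)}:=0$. Then there exist a neighborhood $\mathcal{N}\subset\Xi$ of $\bar\xi$ and continuous maps $x^\star:\mathcal{N}\to\mathbb{R}^n$, $\lambda^\star:\mathcal{N}\to\mathbb{R}^p$, $\mu^\star:\mathcal{N}\to\mathbb{R}^m_{\ge0}$ such that $(x^\star,\lambda^\star,\mu^\star)(\bar\xi)=(\bar x,\bar\lambda,\bar\mu)$ and, for every $\xi\in\mathcal{N}$, $(x^\star(\xi),\lambda^\star(\xi),\mu^\star(\xi))$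 is a regular minimizer for $\xi$ and $x^\star(\xi)$ is a local minimizer of $f(\cdot,\xi)$ on $\mathcal{X}(\xi)$. Moreover, for all such $\mathcal{N}$ and $x^\star,\lambda^\star,\mu^\star$, the maps $x^\star$ and $(\lambda^\star,\mu^\star):\mathcal{N}\to\mathbb{R}^{p+m}$ are locally Lipschitz at $\bar\xi$ with Lipschitz constants bounded by $\ell_{x^\star}$ and $\ell_{(\lambda^\star,\mu^\star)}$, respectively: for every $\ell>\ell_{x^\star}$ there is a neighborhood $U\subset\mathcal{N}$ of $\bar\xi$ with $\|x^\star(\xi)-x^\star(\xi')\|\le\ell\|\xi-\xi'\|$ for all $\xi,\xi'\in U$, and for every $\ell>\ell_{(\lambda^\star,\mu^\star)}$ there is a neighborhood $U\subset\mathcal{N}$ of $\bar\xi$ with $\|(\lambda^\star,\mu^\star)(\xi)-(\lambda^\star,\mu^\star)(\xi')\|\le\ell\|\xi-\xi'\|$ for all $\xi,\xi'\in U$. -/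

import Mathlib

open Set Filter Topology

noncomputable section

/-- The data of a parametrized nonlinear program
`minimize f(x, ξ)` over `x ∈ ℝⁿ` subject to `h(x, ξ) = 0` and `g(x, ξ) ≤ 0`,
with `p` equality constraints, `m` inequality constraints and a parameter `ξ` in `ℝʳ`. -/
structure ParamNLP (n p m r : ℕ) where
  /-- objective -/
  f : EuclideanSpace ℝ (Fin n) → EuclideanSpace ℝ (Fin r) → ℝ
  /-- equality constraints -/
  h : EuclideanSpace ℝ (Fin n) → EuclideanSpace ℝ (Fin r) → EuclideanSpace ℝ (Fin p)
  /-- inequality constraints -/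
  g : EuclideanSpace ℝ (Fin n) → EuclideanSpace ℝ (Fin r) → EuclideanSpace ℝ (Fin m)

namespace ParamNLP

variable {n p m r : ℕ} (P : ParamNLP n p m r)

/-- `f`, `h`, `g` are twice continuously differentiable in `(x, ξ)` on `ℝⁿ × Ξ`. -/
structure IsC2On (Ξ : Set (EuclideanSpace ℝ (Fin r))) : Prop where
  f : ContDiffOn ℝ 2
    (fun z : EuclideanSpace ℝ (Fin n) × EuclideanSpace ℝ (Fin r) => P.f z.1 z.2) (univ ×ˢ Ξ)
  h : ContDiffOn ℝ 2
    (fun z : EuclideanSpace ℝ (Fin n) × EuclideanSpace ℝ (Fin r) => P.h z.1 z.2) (univ ×ˢ Ξ)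
  g : ContDiffOn ℝ 2
    (fun z : EuclideanSpace ℝ (Fin n) × EuclideanSpace ℝ (Fin r) => P.g z.1 z.2) (univ ×ˢ Ξ)

/-- The feasible set `X(ξ)`. -/
def feasible (ξ : EuclideanSpace ℝ (Fin r)) : Set (EuclideanSpace ℝ (Fin n)) :=
  {x | P.h x ξ = 0 ∧ ∀ i, P.g x ξ i ≤ 0}

/-- The index set of the inequality constraints that are active at `x` for the parameter `ξ`. -/
def active (x : EuclideanSpace ℝ (Fin n)) (ξ : EuclideanSpace ℝ (Fin r)) : Finset (Fin m) :=
  (Set.toFinite {i : Fin m | P.g x ξ i = 0}).toFinset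

/-- The Lagrangian `L(x, l, u, ξ) = f(x, ξ) + lᵀ h(x, ξ) + uᵀ g(x, ξ)`. -/
def lagrangian (x : EuclideanSpace ℝ (Fin n)) (l : EuclideanSpace ℝ (Fin p))
    (u : EuclideanSpace ℝ (Fin m)) (ξ : EuclideanSpace ℝ (Fin r)) : ℝ :=
  P.f x ξ + ∑ j, l j * P.h x ξ j + ∑ i, u i * P.g x ξ i

/-- The gradient (a column vector) of the Lagrangian with respect to `x`. -/
def gradL (x : EuclideanSpace ℝ (Fin n)) (l : EuclideanSpace ℝ (Fin p))
    (u : EuclideanSpace ℝ (Fin m)) (ξ : EuclideanSpace ℝ (Fin r)) : EuclideanSpace ℝ (Fin n) :=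
  gradient (fun y => P.lagrangian y l u ξ) x

/-- `A = ∇²ₓₓ L`, the Hessian of the Lagrangian with respect to `x`, as a linear map. -/
def hessL (x : EuclideanSpace ℝ (Fin n)) (l : EuclideanSpace ℝ (Fin p))
    (u : EuclideanSpace ℝ (Fin m)) (ξ : EuclideanSpace ℝ (Fin r)) :
    EuclideanSpace ℝ (Fin n) →L[ℝ] EuclideanSpace ℝ (Fin n) :=
  fderiv ℝ (fun y => P.gradL y l u ξ) x

/-- `L⋆ = ∇²_{ξx} L`, the Jacobian with respect to `ξ` of the `x`-gradient of the Lagrangian. -/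
def mixedL (x : EuclideanSpace ℝ (Fin n)) (l : EuclideanSpace ℝ (Fin p))
    (u : EuclideanSpace ℝ (Fin m)) (ξ : EuclideanSpace ℝ (Fin r)) :
    EuclideanSpace ℝ (Fin r) →L[ℝ] EuclideanSpace ℝ (Fin n) :=
  fderiv ℝ (fun ζ => P.gradL x l u ζ) ξ

/-- The stacked constraint vector `(h, g_S)` for an index set `S` of inequality constraints. -/
def constr (S : Finset (Fin m)) (x : EuclideanSpace ℝ (Fin n)) (ξ : EuclideanSpace ℝ (Fin r)) :
    EuclideanSpace ℝ (Fin p ⊕ S) :=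
  WithLp.toLp 2 (Sum.elim (fun j => P.h x ξ j) (fun i => P.g x ξ i))

/-- `B`: the `x`-Jacobian of the equality constraints stacked with all active inequality
constraints (weakly active ones included). -/
def jacX (x : EuclideanSpace ℝ (Fin n)) (ξ : EuclideanSpace ℝ (Fin r)) :
    EuclideanSpace ℝ (Fin n) →L[ℝ] EuclideanSpace ℝ (Fin p ⊕ P.active x ξ) :=
  fderiv ℝ (fun y => P.constr (P.active x ξ) y ξ) x

/-- `G⋆`: the `ξ`-Jacobian of the equality constraints stacked with all active inequality
constraints (weakly active ones included). -/
def jacXi (x : EuclideanSpace ℝ (Fin n)) (ξ : EuclideanSpace ℝ (Fin r)) :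
    EuclideanSpace ℝ (Fin r) →L[ℝ] EuclideanSpace ℝ (Fin p ⊕ P.active x ξ) :=
  fderiv ℝ (fun ζ => P.constr (P.active x ξ) x ζ) ξ

/-- Linear independence constraint qualification: the `x`-gradients of the equality constraints
and of the active inequality constraints are linearly independent. -/
def LICQ (x : EuclideanSpace ℝ (Fin n)) (ξ : EuclideanSpace ℝ (Fin r)) : Prop :=
  LinearIndependent ℝ (fun k : Fin p ⊕ P.active x ξ =>
    gradient (fun y => P.constr (P.active x ξ) y ξ k) x)

/-- The Karush-Kuhn-Tucker conditions. -/
structure KKT (x : EuclideanSpace ℝ (Fin n)) (l : EuclideanSpace ℝ (Fin p))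
    (u : EuclideanSpace ℝ (Fin m)) (ξ : EuclideanSpace ℝ (Fin r)) : Prop where
  mem_feasible : x ∈ P.feasible ξ
  nonneg : ∀ i, 0 ≤ u i
  stationary : P.gradL x l u ξ = 0
  compl : ∀ i, P.g x ξ i < 0 → u i = 0

/-- Strong second-order sufficiency condition. -/
def SSOSC (x : EuclideanSpace ℝ (Fin n)) (l : EuclideanSpace ℝ (Fin p))
    (u : EuclideanSpace ℝ (Fin m)) (ξ : EuclideanSpace ℝ (Fin r)) : Prop :=
  ∀ y : EuclideanSpace ℝ (Fin n), y ≠ 0 →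
    fderiv ℝ (fun z => P.h z ξ) x y = 0 →
    (∀ i, 0 < u i → fderiv ℝ (fun z => P.g z ξ i) x y = 0) →
    0 < inner ℝ y (P.hessL x l u ξ y)

/-- `(x, l, u)` is a regular minimizer for the parameter `ξ`. -/
structure IsRegularMinimizer (x : EuclideanSpace ℝ (Fin n)) (l : EuclideanSpace ℝ (Fin p))
    (u : EuclideanSpace ℝ (Fin m)) (ξ : EuclideanSpace ℝ (Fin r)) : Prop where
  licq : P.LICQ x ξ
  kkt : P.KKT x l u ξ
  ssosc : P.SSOSC x l u ξ

/-- `(xs, ls, us)` are continuous primal and dual solution maps on a neighborhood `N ⊆ Ξ` of `ξ₀`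
through the point `(x₀, l₀, u₀)`. Only the values of the maps on `N` matter. -/
structure IsSolutionMap (Ξ : Set (EuclideanSpace ℝ (Fin r)))
    (x₀ : EuclideanSpace ℝ (Fin n)) (l₀ : EuclideanSpace ℝ (Fin p))
    (u₀ : EuclideanSpace ℝ (Fin m)) (ξ₀ : EuclideanSpace ℝ (Fin r))
    (N : Set (EuclideanSpace ℝ (Fin r)))
    (xs : EuclideanSpace ℝ (Fin r) → EuclideanSpace ℝ (Fin n))
    (ls : EuclideanSpace ℝ (Fin r) → EuclideanSpace ℝ (Fin p))
    (us : EuclideanSpace ℝ (Fin r) → EuclideanSpace ℝ (Fin m)) : Prop where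
  mem_nhds : N ∈ 𝓝 ξ₀
  subset : N ⊆ Ξ
  continuousOn_x : ContinuousOn xs N
  continuousOn_l : ContinuousOn ls N
  continuousOn_u : ContinuousOn us N
  base_x : xs ξ₀ = x₀
  base_l : ls ξ₀ = l₀
  base_u : us ξ₀ = u₀
  regular : ∀ ξ ∈ N, P.IsRegularMinimizer (xs ξ) (ls ξ) (us ξ) ξ
  isLocalMin : ∀ ξ ∈ N, IsLocalMinOn (fun x => P.f x ξ) (P.feasible ξ) (xs ξ)

end ParamNLP

/-- Largest (real) eigenvalue. -/
def lamMax {n : ℕ} (A : EuclideanSpace ℝ (Fin n) →L[ℝ] EuclideanSpace ℝ (Fin n)) : ℝ :=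
  sSup {t : ℝ | Module.End.HasEigenvalue A.toLinearMap t}

/-- Smallest (real) eigenvalue. -/
def lamMin {n : ℕ} (A : EuclideanSpace ℝ (Fin n) →L[ℝ] EuclideanSpace ℝ (Fin n)) : ℝ :=
  sInf {t : ℝ | Module.End.HasEigenvalue A.toLinearMap t}

/-- Smallest singular value of an `a × b` matrix: the last one of its `min a b` singular values
in descending order (Mathlib numbers them from `0`). -/
def sigmaMin {ι κ : Type*} [Fintype ι] [Fintype κ]
    (T : EuclideanSpace ℝ ι →L[ℝ] EuclideanSpace ℝ κ) : ℝ :=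
  T.toLinearMap.singularValues (min (Fintype.card ι) (Fintype.card κ) - 1)

namespace ParamNLP

variable {n p m r : ℕ} (P : ParamNLP n p m r)

/-- `‖L⋆‖ / λmin(A) + ‖G⋆‖ / σmin(Bᵀ)`. If there are no equality constraints and no active
inequality constraints, then `G⋆ = 0` and the second summand is `0`. -/
def ellBase (x : EuclideanSpace ℝ (Fin n)) (l : EuclideanSpace ℝ (Fin p))
    (u : EuclideanSpace ℝ (Fin m)) (ξ : EuclideanSpace ℝ (Fin r)) : ℝ :=
  ‖P.mixedL x l u ξ‖ / lamMin (P.hessL x l u ξ)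
    + ‖P.jacXi x ξ‖ / sigmaMin (ContinuousLinearMap.adjoint (P.jacX x ξ))

/-- The bound for the Lipschitz constant of the primal solution map. -/
def ellPrimal (x : EuclideanSpace ℝ (Fin n)) (l : EuclideanSpace ℝ (Fin p))
    (u : EuclideanSpace ℝ (Fin m)) (ξ : EuclideanSpace ℝ (Fin r)) : ℝ :=
  √(lamMax (P.hessL x l u ξ) / lamMin (P.hessL x l u ξ)) * P.ellBase x l u ξ

open Classical in
/-- The bound for the Lipschitz constant of the dual solution map. If there are no equality
constraints and no active inequality constraints, then `B` has no rows and the bound is `0`. -/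
def ellDual (x : EuclideanSpace ℝ (Fin n)) (l : EuclideanSpace ℝ (Fin p))
    (u : EuclideanSpace ℝ (Fin m)) (ξ : EuclideanSpace ℝ (Fin r)) : ℝ :=
  if IsEmpty (Fin p ⊕ P.active x ξ) then 0
  else
    lamMax (P.hessL x l u ξ) ^ (3 / 2 : ℝ)
      / (sigmaMin (ContinuousLinearMap.adjoint (P.jacX x ξ))
          * lamMin (P.hessL x l u ξ) ^ (1 / 2 : ℝ))
      * P.ellBase x l u ξ

end ParamNLP

/-- `F : S → Y` is locally Lipschitz at `a ∈ S` with constant bounded by `ℓ₀`: for every `ℓ > ℓ₀`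
there is a relative neighborhood of `a` in `S` on which `F` is `ℓ`-Lipschitz. -/
def LocallyLipschitzAtWith {X Y : Type*} [NormedAddCommGroup X] [NormedAddCommGroup Y]
    (ℓ₀ : ℝ) (F : X → Y) (S : Set X) (a : X) : Prop :=
  ∀ ℓ : ℝ, ℓ₀ < ℓ → ∃ U ∈ 𝓝[S] a, U ⊆ S ∧ ∀ y ∈ U, ∀ z ∈ U, ‖F y - F z‖ ≤ ℓ * ‖y - z‖

end

/-!
Near the base point, where the constraints outside the active set `S` stay inactive, the KKT
conditions are the variational inequality `Ψ(v, ξ, x) = 0`, `c(x, ξ) ∈ normalCone K v`: here `Ψ` is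
the gradient of the Lagrangian in `x`, `c` collects the constraints in `S`, and `K` is the cone of
multipliers `v = (λ, μ_S)` with `μ_S ≥ 0`. Weakly active constraints need no special treatment,
since complementarity is encoded in the normal cone.

*Lipschitz bounds.* Normal cones are monotone, so the differences of two solutions satisfy
`⟪Δv, Δc⟫ ≥ 0`. Up to errors that are small relative to the differences, they also satisfy
`A Δx + Bᵀ Δv = -L Δξ` and `B Δx + G Δξ = Δc`. Writing `Δx = p - q` with `A q = Bᵀ Δv` and
estimating in the norm induced by `A` yields the constants.

*Existence.* The implicit function theorem solves `Ψ = 0` for `x = X(v, ξ)`. The derivative of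
`v ↦ c(X(v, ξ), ξ)` at the base point is `-B A⁻¹ Bᵀ`, which is negative definite by LICQ. Hence
`v ↦ proj_K (v + ρ c(X(v, ξ), ξ))` is a contraction for small `ρ > 0`, and its fixed points are the
solutions of the variational inequality.
-/

open scoped InnerProductSpace
open ContinuousLinearMap (adjoint)

section SaddlePoint

variable {E : Type*} [NormedAddCommGroup E] [InnerProductSpace ℝ E]

/-- The norm of the inner product `(y, z) ↦ ⟪y, A z⟫` induced by a positive operator `A`; the
square root is `0` where `⟪y, A y⟫` is negative. -/
noncomputable def energyNorm (A : E →L[ℝ] E) (y : E) : ℝ :=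
  √⟪y, A y⟫_ℝ

lemma energyNorm_nonneg (A : E →L[ℝ] E) (y : E) : 0 ≤ energyNorm A y :=
  Real.sqrt_nonneg _

variable {F : Type*} [NormedAddCommGroup F] [InnerProductSpace ℝ F] [CompleteSpace E]
  [CompleteSpace F]
  {A : E →L[ℝ] E} {B : E →L[ℝ] F} {a b σ : ℝ}

/-- The operator of a saddle point system `A x + adjoint B v = e`, `B x = γ` in quantitative form:
`A` is symmetric with spectrum in `[a, b]`, where `0 < a`, and `adjoint B` is bounded below by
`σ > 0`. -/
structure HasSaddleBounds (A : E →L[ℝ] E) (B : E →L[ℝ] F) (a b σ : ℝ) : Prop where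
  isSymmetric : A.toLinearMap.IsSymmetric
  lower_pos : 0 < a
  lower_le_upper : a ≤ b
  lower : ∀ y, a * ‖y‖ ^ 2 ≤ ⟪y, A y⟫_ℝ
  upper : ∀ y, ⟪y, A y⟫_ℝ ≤ b * ‖y‖ ^ 2
  adjoint_pos : 0 < σ
  adjoint_lower : ∀ v, σ * ‖v‖ ≤ ‖adjoint B v‖

lemma exists_continuousLinearEquiv_of_coercive (ha : 0 < a)
    (hA : ∀ y, a * ‖y‖ ^ 2 ≤ ⟪y, A y⟫_ℝ) : ∃ e : E ≃L[ℝ] E, (e : E →L[ℝ] E) = A := by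
  have hcoercive : IsCoercive (innerSL ℝ ∘L A) := ⟨a, ha, fun y => by
    rw [ContinuousLinearMap.comp_apply, innerSL_apply_apply, real_inner_comm, mul_assoc, ← sq]
    exact hA y⟩
  refine ⟨hcoercive.continuousLinearEquivOfBilin, ContinuousLinearMap.ext fun y => ?_⟩
  exact ext_inner_right ℝ fun z => hcoercive.continuousLinearEquivOfBilin_apply y z

namespace HasSaddleBounds

lemma upper_pos (h : HasSaddleBounds A B a b σ) : 0 < b :=
  h.lower_pos.trans_le h.lower_le_upper

lemma adjoint_injective (h : HasSaddleBounds A B a b σ) : Function.Injective (adjoint B) := by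
  refine (injective_iff_map_eq_zero _).2 fun v hv => norm_le_zero_iff.1 ?_
  have hle := h.adjoint_lower v
  rw [hv, norm_zero] at hle
  exact nonpos_of_mul_nonpos_right hle h.adjoint_pos

lemma inner_apply_self_nonneg (h : HasSaddleBounds A B a b σ) (y : E) : 0 ≤ ⟪y, A y⟫_ℝ :=
  (mul_nonneg h.lower_pos.le (sq_nonneg _)).trans (h.lower y)

lemma sq_energyNorm (h : HasSaddleBounds A B a b σ) (y : E) : energyNorm A y ^ 2 = ⟪y, A y⟫_ℝ :=
  Real.sq_sqrt (h.inner_apply_self_nonneg y)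

lemma inner_apply_comm (h : HasSaddleBounds A B a b σ) (y z : E) : ⟪y, A z⟫_ℝ = ⟪z, A y⟫_ℝ := by
  rw [real_inner_comm]
  exact h.isSymmetric z y

lemma inner_apply_le_energyNorm_mul (h : HasSaddleBounds A B a b σ) (y z : E) :
    ⟪y, A z⟫_ℝ ≤ energyNorm A y * energyNorm A z := by
  refine le_of_sq_le_sq ?_ (mul_nonneg (energyNorm_nonneg A y) (energyNorm_nonneg A z))
  rw [mul_pow, h.sq_energyNorm, h.sq_energyNorm]
  let form : LinearMap.BilinForm ℝ E := (innerₗ E).compl₂ A.toLinearMap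
  have hsymm : LinearMap.IsSymm form := ⟨fun y z => h.inner_apply_comm y z⟩
  exact form.apply_sq_le_of_symm h.inner_apply_self_nonneg hsymm y z

lemma sqrt_mul_norm_le_energyNorm (h : HasSaddleBounds A B a b σ) (y : E) :
    √a * ‖y‖ ≤ energyNorm A y := by
  rw [energyNorm, ← Real.sqrt_sq (norm_nonneg y), ← Real.sqrt_mul h.lower_pos.le]
  exact Real.sqrt_le_sqrt (h.lower y)

lemma energyNorm_le_sqrt_mul_norm (h : HasSaddleBounds A B a b σ) (y : E) :
    energyNorm A y ≤ √b * ‖y‖ := by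
  rw [energyNorm, ← Real.sqrt_sq (norm_nonneg y), ← Real.sqrt_mul h.upper_pos.le]
  exact Real.sqrt_le_sqrt (h.upper y)

lemma sqrt_mul_energyNorm_le_norm_apply (h : HasSaddleBounds A B a b σ) (y : E) :
    √a * energyNorm A y ≤ ‖A y‖ := by
  have hle : energyNorm A y * (√a * energyNorm A y) ≤ energyNorm A y * ‖A y‖ :=
    calc energyNorm A y * (√a * energyNorm A y) = √a * ⟪y, A y⟫_ℝ := by
          rw [← h.sq_energyNorm]; ring
      _ ≤ √a * (‖y‖ * ‖A y‖) := by gcongr; exact real_inner_le_norm _ _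
      _ = √a * ‖y‖ * ‖A y‖ := by ring
      _ ≤ energyNorm A y * ‖A y‖ := by gcongr; exact h.sqrt_mul_norm_le_energyNorm y
  rcases (energyNorm_nonneg A y).eq_or_lt with h0 | hpos
  · simp [← h0]
  · exact le_of_mul_le_mul_left hle hpos

lemma norm_apply_le_sqrt_mul_energyNorm (h : HasSaddleBounds A B a b σ) (y : E) :
    ‖A y‖ ≤ √b * energyNorm A y := by
  have hle : ‖A y‖ * ‖A y‖ ≤ ‖A y‖ * (√b * energyNorm A y) :=
    calc ‖A y‖ * ‖A y‖ = ⟪A y, A y⟫_ℝ := (real_inner_self_eq_norm_mul_norm _).symm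
      _ ≤ energyNorm A (A y) * energyNorm A y := h.inner_apply_le_energyNorm_mul _ _
      _ ≤ √b * ‖A y‖ * energyNorm A y := by
          gcongr
          · exact energyNorm_nonneg A y
          · exact h.energyNorm_le_sqrt_mul_norm _
      _ = ‖A y‖ * (√b * energyNorm A y) := by ring
  rcases (norm_nonneg (A y)).eq_or_lt with h0 | hpos
  · rw [← h0]
    exact mul_nonneg (Real.sqrt_nonneg b) (energyNorm_nonneg A y)
  · exact le_of_mul_le_mul_left hle hpos

lemma mul_norm_le_of_apply_eq_adjoint (h : HasSaddleBounds A B a b σ) {q : E} {v : F}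
    (hq : A q = adjoint B v) : σ * ‖v‖ ≤ √b * energyNorm A q := by
  have := h.norm_apply_le_sqrt_mul_energyNorm q
  rw [hq] at this
  exact (h.adjoint_lower v).trans this

lemma energyNorm_le_of_neg_mul_le_inner (h : HasSaddleBounds A B a b σ) {p q : E} {g : ℝ}
    (hg : 0 ≤ g) (hpq : -(g * energyNorm A q) ≤ ⟪p - q, A q⟫_ℝ) :
    energyNorm A q ≤ energyNorm A p + g ∧ energyNorm A (p - q) ≤ energyNorm A p + g := by
  have hp0 := energyNorm_nonneg A p
  have hq0 := energyNorm_nonneg A q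
  have hsub : energyNorm A (p - q) ^ 2 =
      energyNorm A p ^ 2 - 2 * ⟪p, A q⟫_ℝ + energyNorm A q ^ 2 := by
    simp only [h.sq_energyNorm, map_sub, inner_sub_left, inner_sub_right, h.inner_apply_comm q p]
    ring
  rw [inner_sub_left, ← h.sq_energyNorm q] at hpq
  have hcs := h.inner_apply_le_energyNorm_mul p q
  constructor
  · have hle : energyNorm A q * energyNorm A q ≤ energyNorm A q * (energyNorm A p + g) := by
      linarith
    rcases hq0.eq_or_lt with h0 | hpos
    · rw [← h0]; positivity
    · exact le_of_mul_le_mul_left hle hpos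
  · exact le_of_sq_le_sq (by nlinarith [sq_nonneg (energyNorm A q - g)]) (by positivity)

/-- Split `x = p - q` with `A p = e` and `A q = adjoint B v`: the sign condition then bounds the
energy inner product of `x` and `q` from below. -/
theorem norm_le_and_norm_le (h : HasSaddleBounds A B a b σ) {x e : E} {v γ : F}
    (hstat : A x + adjoint B v = e) (hsign : ⟪v, γ⟫_ℝ ≤ ⟪v, B x⟫_ℝ) :
    ‖x‖ ≤ √(b / a) * (‖e‖ / a + ‖γ‖ / σ) ∧ ‖v‖ ≤ b / σ * (‖e‖ / a + ‖γ‖ / σ) := by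
  have ha := h.lower_pos
  have hb := h.upper_pos
  have hσ := h.adjoint_pos
  obtain ⟨A', rfl⟩ := exists_continuousLinearEquiv_of_coercive ha h.lower
  obtain ⟨q, hq⟩ := A'.surjective (adjoint B v)
  obtain ⟨p, rfl⟩ : ∃ p, x = p - q := ⟨x + q, by abel⟩
  have hp : A' p = e := by simpa [hq] using hstat
  have hv := h.mul_norm_le_of_apply_eq_adjoint hq
  set A := (A' : E →L[ℝ] E)
  set g := √b * ‖γ‖ / σ with hg
  have hinner : -(g * energyNorm A q) ≤ ⟪p - q, A q⟫_ℝ :=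
    calc -(g * energyNorm A q) = -(√b * energyNorm A q / σ * ‖γ‖) := by rw [hg]; ring
      _ ≤ -(‖v‖ * ‖γ‖) := by
          gcongr
          rwa [le_div_iff₀ hσ, mul_comm]
      _ ≤ ⟪v, γ⟫_ℝ := neg_le_of_abs_le (abs_real_inner_le_norm v γ)
      _ ≤ ⟪v, B (p - q)⟫_ℝ := hsign
      _ = ⟪p - q, A q⟫_ℝ := by
          rw [real_inner_comm, ← ContinuousLinearMap.adjoint_inner_right, ← hq]
          rfl
  have hsum : energyNorm A p + g ≤ √b * (‖e‖ / a + ‖γ‖ / σ) :=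
    calc energyNorm A p + g ≤ ‖e‖ / √a + g := by
          gcongr
          rw [le_div_iff₀ (Real.sqrt_pos.2 ha), mul_comm, ← hp]
          exact h.sqrt_mul_energyNorm_le_norm_apply p
      _ = √a * (‖e‖ / a) + g := by
          rw [mul_div_left_comm, Real.sqrt_div_self', mul_one_div]
      _ ≤ √b * (‖e‖ / a) + g := by gcongr; exact h.lower_le_upper
      _ = √b * (‖e‖ / a + ‖γ‖ / σ) := by rw [hg]; ring
  obtain ⟨hqN, hxN⟩ := h.energyNorm_le_of_neg_mul_le_inner (by positivity) hinner
  constructor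
  · rw [Real.sqrt_div hb.le, div_mul_eq_mul_div, le_div_iff₀ (Real.sqrt_pos.2 ha), mul_comm]
    exact (h.sqrt_mul_norm_le_energyNorm _).trans (hxN.trans hsum)
  · rw [div_mul_eq_mul_div, le_div_iff₀ hσ, mul_comm]
    calc σ * ‖v‖ ≤ √b * energyNorm A q := hv
      _ ≤ √b * (√b * (‖e‖ / a + ‖γ‖ / σ)) := by gcongr; exact hqN.trans hsum
      _ = b * (‖e‖ / a + ‖γ‖ / σ) := by rw [← mul_assoc, Real.mul_self_sqrt hb.le]

end HasSaddleBounds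

end SaddlePoint

section LinearApproximation

variable {E F R : Type*} [NormedAddCommGroup E] [NormedSpace ℝ E] [NormedAddCommGroup F]
  [NormedSpace ℝ F] [NormedAddCommGroup R] [NormedSpace ℝ R]

lemma norm_apply_sub_sub_le_of_approximatesLinearOn_coprod {c : E × R → F} {B : E →L[ℝ] F}
    {G : R →L[ℝ] F} {x x' : E} {ξ ξ' : R} {W : Set (E × R)} {ε : NNReal}
    (hc : ApproximatesLinearOn c (B.coprod G) W ε) (hW : (x, ξ) ∈ W) (hW' : (x', ξ') ∈ W) :
    ‖B (x - x') - (c (x, ξ) - c (x', ξ'))‖ ≤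
      ‖G‖ * ‖ξ - ξ'‖ + ε * (‖x - x'‖ + ‖ξ - ξ'‖) := by
  have happrox := hc _ hW _ hW'
  have hnorm : ‖(x, ξ) - (x', ξ')‖ ≤ ‖x - x'‖ + ‖ξ - ξ'‖ :=
    max_le (le_add_of_nonneg_right (norm_nonneg _)) (le_add_of_nonneg_left (norm_nonneg _))
  calc ‖B (x - x') - (c (x, ξ) - c (x', ξ'))‖
      = ‖-G (ξ - ξ') - (c (x, ξ) - c (x', ξ') - B.coprod G ((x, ξ) - (x', ξ')))‖ := by
        simp only [Prod.mk_sub_mk, ContinuousLinearMap.coprod_apply]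
        congr 1; abel
    _ ≤ ‖G‖ * ‖ξ - ξ'‖ + ε * (‖x - x'‖ + ‖ξ - ξ'‖) := by
        refine (norm_sub_le _ _).trans (add_le_add ?_ (happrox.trans (by gcongr)))
        rw [norm_neg]
        exact G.le_opNorm _

end LinearApproximation

section PrimalDual

variable {E F R : Type*} [NormedAddCommGroup E] [NormedAddCommGroup F] [InnerProductSpace ℝ F]

/-- The cone of outward normals to a convex set `K` at a point `v` of `K`. -/
def normalCone (K : Set F) (v : F) : Set F :=
  {φ | ∀ w ∈ K, ⟪φ, w - v⟫_ℝ ≤ 0}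

/-- The first-order system `Ψ(v, ξ, x) = 0`, `c(x, ξ) ∈ normalCone K v` with a set `K` of
admissible multipliers. For a cone `K` the inclusion says that `c(x, ξ)` lies in the polar cone of
`K` and is complementary to `v`. The variable `x` comes last in `Ψ` because it is the one that the
implicit function theorem eliminates. -/
structure IsPrimalDualSolution (K : Set F) (Ψ : (F × R) × E → E) (c : E × R → F)
    (x : E) (v : F) (ξ : R) : Prop where
  mem : v ∈ K
  stationary : Ψ ((v, ξ), x) = 0
  mem_normalCone : c (x, ξ) ∈ normalCone K v

lemma IsPrimalDualSolution.inner_sub_sub_nonneg {K : Set F} {Ψ : (F × R) × E → E}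
    {c : E × R → F} {x x' : E} {v v' : F} {ξ ξ' : R} (h : IsPrimalDualSolution K Ψ c x v ξ)
    (h' : IsPrimalDualSolution K Ψ c x' v' ξ') :
    0 ≤ ⟪v - v', c (x, ξ) - c (x', ξ')⟫_ℝ := by
  have hv := h.mem_normalCone v' h'.mem
  have hv' := h'.mem_normalCone v h.mem
  rw [← neg_sub v v', inner_neg_right] at hv
  rw [real_inner_comm, inner_sub_left]
  linarith

lemma mul_div_add_div_le {a σ t T e γ g l d δ : ℝ} (ha : 0 < a) (hσ : 0 < σ) (ht : 0 ≤ t)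
    (htT : t ≤ T) (hδ : 0 ≤ δ) (he : e ≤ l * d + δ) (hγ : γ ≤ g * d + δ) :
    t * (e / a + γ / σ) ≤ t * (l / a + g / σ) * d + T * (1 / a + 1 / σ) * δ :=
  calc t * (e / a + γ / σ) ≤ t * ((l * d + δ) / a + (g * d + δ) / σ) := by gcongr
    _ = t * (l / a + g / σ) * d + t * (1 / a + 1 / σ) * δ := by ring
    _ ≤ t * (l / a + g / σ) * d + T * (1 / a + 1 / σ) * δ := by gcongr

/-- The error terms `η * (X + V + d)` are absorbed into the left-hand sides. -/
lemma exists_pos_forall_le_mul_of_le_add {k₁ k₂ ℓ₁ ℓ₂ : ℝ} (hk₁ : 0 ≤ k₁) (hk₂ : 0 ≤ k₂)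
    (hℓ₁ : k₁ < ℓ₁) (hℓ₂ : k₂ < ℓ₂) :
    ∃ η > 0, ∀ {d X V : ℝ}, 0 ≤ d → X ≤ k₁ * d + η * (X + V + d) →
      V ≤ k₂ * d + η * (X + V + d) → X ≤ ℓ₁ * d ∧ V ≤ ℓ₂ * d := by
  set k := k₁ + k₂ + 1
  set δ := min (ℓ₁ - k₁) (ℓ₂ - k₂)
  have : 0 < δ := lt_min (sub_pos.2 hℓ₁) (sub_pos.2 hℓ₂)
  refine ⟨min (1 / 4) (δ / (2 * k)), by positivity, fun {d X V} hd hX hV => ?_⟩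
  set η := min (1 / 4) (δ / (2 * k))
  have hη : 0 < η := by positivity
  have hηk : η * (2 * k) ≤ δ := (le_div_iff₀ (by positivity)).1 (min_le_right _ _)
  have herror : η * (X + V + d) ≤ δ * d := by
    rcases le_total (X + V + d) 0 with hs | hs
    · exact (mul_nonpos_of_nonneg_of_nonpos hη.le hs).trans (by positivity)
    · have hη4 : η * (X + V + d) ≤ 1 / 4 * (X + V + d) := by gcongr; exact min_le_left _ _
      have hsum : X + V + d ≤ 2 * k * d := by linarith
      calc η * (X + V + d) ≤ η * (2 * k) * d := by rw [mul_assoc]; gcongr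
        _ ≤ δ * d := by gcongr
  have hδ₁ : δ * d ≤ (ℓ₁ - k₁) * d := by gcongr; exact min_le_left _ _
  have hδ₂ : δ * d ≤ (ℓ₂ - k₂) * d := by gcongr; exact min_le_right _ _
  constructor <;> linarith

variable [InnerProductSpace ℝ E] [NormedAddCommGroup R] [NormedSpace ℝ R]
  {K : Set F} {Ψ : (F × R) × E → E} {c : E × R → F}
  {A : E →L[ℝ] E} {B : E →L[ℝ] F} {L : R →L[ℝ] E} {G : R →L[ℝ] F} {a b σ : ℝ}

variable [CompleteSpace E] [CompleteSpace F]

lemma IsPrimalDualSolution.norm_stationarity_residual_le {x x' : E} {v v' : F} {ξ ξ' : R}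
    {W : Set ((F × R) × E)} {ε : NNReal}
    (hΨ : ApproximatesLinearOn Ψ (((adjoint B).coprod L).coprod A) W ε)
    (h : IsPrimalDualSolution K Ψ c x v ξ) (h' : IsPrimalDualSolution K Ψ c x' v' ξ')
    (hW : ((v, ξ), x) ∈ W) (hW' : ((v', ξ'), x') ∈ W) :
    ‖A (x - x') + adjoint B (v - v')‖ ≤
      ‖L‖ * ‖ξ - ξ'‖ + ε * (‖x - x'‖ + ‖v - v'‖ + ‖ξ - ξ'‖) := by
  have happrox := hΨ _ hW _ hW'
  rw [h.stationary, h'.stationary, sub_self, zero_sub, norm_neg] at happrox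
  have hnorm : ‖((v, ξ), x) - ((v', ξ'), x')‖ ≤ ‖x - x'‖ + ‖v - v'‖ + ‖ξ - ξ'‖ := by
    refine max_le (max_le ?_ ?_) ?_ <;> simp only [Prod.fst_sub, Prod.snd_sub] <;>
      linarith [norm_nonneg (x - x'), norm_nonneg (v - v'), norm_nonneg (ξ - ξ')]
  calc ‖A (x - x') + adjoint B (v - v')‖
      = ‖((adjoint B).coprod L).coprod A (((v, ξ), x) - ((v', ξ'), x')) - L (ξ - ξ')‖ := by
        simp only [Prod.mk_sub_mk, ContinuousLinearMap.coprod_apply]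
        congr 1; abel
    _ ≤ ε * (‖x - x'‖ + ‖v - v'‖ + ‖ξ - ξ'‖) + ‖L‖ * ‖ξ - ξ'‖ :=
        (norm_sub_le _ _).trans (add_le_add (happrox.trans (by gcongr)) (L.le_opNorm _))
    _ = _ := add_comm _ _

theorem HasSaddleBounds.exists_nhds_forall_norm_sub_le (hAB : HasSaddleBounds A B a b σ)
    {x₀ : E} {v₀ : F} {ξ₀ : R}
    (hΨ : HasStrictFDerivAt Ψ (((adjoint B).coprod L).coprod A) ((v₀, ξ₀), x₀))
    (hc : HasStrictFDerivAt c (B.coprod G) (x₀, ξ₀)) {ℓ₁ ℓ₂ : ℝ}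
    (hℓ₁ : √(b / a) * (‖L‖ / a + ‖G‖ / σ) < ℓ₁) (hℓ₂ : b / σ * (‖L‖ / a + ‖G‖ / σ) < ℓ₂) :
    ∃ W ∈ 𝓝 ((v₀, ξ₀), x₀), ∀ x v ξ x' v' ξ', ((v, ξ), x) ∈ W → ((v', ξ'), x') ∈ W →
      IsPrimalDualSolution K Ψ c x v ξ → IsPrimalDualSolution K Ψ c x' v' ξ' →
        ‖x - x'‖ ≤ ℓ₁ * ‖ξ - ξ'‖ ∧ ‖v - v'‖ ≤ ℓ₂ * ‖ξ - ξ'‖ := by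
  have ha := hAB.lower_pos
  have hb := hAB.upper_pos
  have hσ := hAB.adjoint_pos
  obtain ⟨η, hη, habsorb⟩ := exists_pos_forall_le_mul_of_le_add (by positivity) (by positivity)
    hℓ₁ hℓ₂
  set C := (√(b / a) + b / σ) * (1 / a + 1 / σ)
  obtain ⟨ε, hε⟩ : ∃ ε : NNReal, ε = η / C := ⟨⟨η / C, by positivity⟩, rfl⟩
  have hε0 : 0 < ε := by rw [← NNReal.coe_pos, hε]; positivity
  obtain ⟨W₁, hW₁, hΨW⟩ := hΨ.approximates_deriv_on_nhds (Or.inr hε0)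
  obtain ⟨W₂, hW₂, hcW⟩ := hc.approximates_deriv_on_nhds (Or.inr hε0)
  have hW : Tendsto (fun z : (F × R) × E => (z.2, z.1.2)) (𝓝 ((v₀, ξ₀), x₀)) (𝓝 (x₀, ξ₀)) :=
    Continuous.tendsto' (by fun_prop) _ _ rfl
  refine ⟨_, inter_mem hW₁ (hW hW₂), fun x v ξ x' v' ξ' hz hz' h h' => ?_⟩
  set s := ‖x - x'‖ + ‖v - v'‖ + ‖ξ - ξ'‖
  have he := h.norm_stationarity_residual_le hΨW h' hz.1 hz'.1
  have hγ : ‖B (x - x') - (c (x, ξ) - c (x', ξ'))‖ ≤ ‖G‖ * ‖ξ - ξ'‖ + ε * s := by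
    refine (norm_apply_sub_sub_le_of_approximatesLinearOn_coprod hcW hz.2 hz'.2).trans ?_
    gcongr
    linarith [norm_nonneg (v - v')]
  have hsign : ⟪v - v', B (x - x') - (c (x, ξ) - c (x', ξ'))⟫_ℝ ≤ ⟪v - v', B (x - x')⟫_ℝ := by
    rw [inner_sub_right]
    exact sub_le_self _ (h.inner_sub_sub_nonneg h')
  obtain ⟨hx, hv⟩ := hAB.norm_le_and_norm_le rfl hsign
  have hbound : ∀ {t : ℝ}, 0 ≤ t → t ≤ √(b / a) + b / σ →
      t * (‖A (x - x') + adjoint B (v - v')‖ / a +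
        ‖B (x - x') - (c (x, ξ) - c (x', ξ'))‖ / σ) ≤
          t * (‖L‖ / a + ‖G‖ / σ) * ‖ξ - ξ'‖ + η * s := fun {t} ht0 ht => by
    refine (mul_div_add_div_le ha hσ ht0 ht (by positivity) he hγ).trans_eq ?_
    rw [hε, ← mul_assoc, mul_div_cancel₀ _ (by positivity)]
  refine habsorb (norm_nonneg (ξ - ξ')) (hx.trans (hbound (by positivity) ?_))
    (hv.trans (hbound (by positivity) ?_))
  · exact le_add_of_nonneg_right (by positivity)
  · exact le_add_of_nonneg_left (by positivity)

end PrimalDual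

section NormalCone

variable {F : Type*} [NormedAddCommGroup F] [InnerProductSpace ℝ F] {K : Set F}

lemma smul_mem_normalCone_iff {ρ : ℝ} (hρ : 0 < ρ) {φ v : F} :
    ρ • φ ∈ normalCone K v ↔ φ ∈ normalCone K v :=
  forall₂_congr fun w _ => by
    rw [real_inner_smul_left, mul_nonpos_iff_pos_imp_nonpos]
    simp [hρ, hρ.le]

lemma exists_sub_mem_normalCone [CompleteSpace F] (hne : K.Nonempty) (hclosed : IsClosed K)
    (hconv : Convex ℝ K) (u : F) : ∃ p ∈ K, u - p ∈ normalCone K p := by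
  obtain ⟨p, hp, hdist⟩ :=
    exists_norm_eq_iInf_of_complete_convex hne hclosed.isComplete hconv u
  exact ⟨p, hp, (norm_eq_iInf_iff_real_inner_le_zero hconv hp).1 hdist⟩

lemma norm_sub_le_of_sub_mem_normalCone {u u' p p' : F} (hp : p ∈ K) (hp' : p' ∈ K)
    (hu : u - p ∈ normalCone K p) (hu' : u' - p' ∈ normalCone K p') : ‖p - p'‖ ≤ ‖u - u'‖ := by
  have h1 := hu p' hp'
  have h2 := hu' p hp
  have hle : ‖p - p'‖ * ‖p - p'‖ ≤ ‖u - u'‖ * ‖p - p'‖ :=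
    calc ‖p - p'‖ * ‖p - p'‖ = ⟪p - p', p - p'⟫_ℝ := (real_inner_self_eq_norm_mul_norm _).symm
      _ ≤ ⟪u - u', p - p'⟫_ℝ := by
          simp only [inner_sub_left, inner_sub_right] at h1 h2 ⊢
          linarith
      _ ≤ ‖u - u'‖ * ‖p - p'‖ := real_inner_le_norm _ _
  rcases (norm_nonneg (p - p')).eq_or_lt with h0 | hpos
  · exact h0 ▸ norm_nonneg _
  · exact le_of_mul_le_mul_right hle hpos

lemma exists_norm_add_smul_le (S : F →L[ℝ] F) {s : ℝ} (hs : 0 < s)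
    (hS : ∀ w, ⟪w, S w⟫_ℝ ≤ -(s * ‖w‖ ^ 2)) :
    ∃ ρ > (0 : ℝ), ∃ q > 0, q < 1 ∧ ∀ w, ‖w + ρ • S w‖ ≤ (1 - q) * ‖w‖ := by
  set D := ‖S‖ ^ 2 + s ^ 2 with hD
  set ρ := s / D
  have hρ : 0 < ρ := by positivity
  have hρD : ρ * D = s := div_mul_cancel₀ s (by positivity)
  have hρs : ρ * s ≤ 1 := by
    rw [div_mul_eq_mul_div, div_le_one (by positivity), ← sq]
    exact le_add_of_nonneg_left (sq_nonneg _)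
  refine ⟨ρ, hρ, ρ * s / 2, by positivity, by linarith, fun w => ?_⟩
  refine le_of_sq_le_sq ?_ (mul_nonneg (by linarith) (norm_nonneg w))
  calc ‖w + ρ • S w‖ ^ 2 = ‖w‖ ^ 2 + 2 * ρ * ⟪w, S w⟫_ℝ + ρ ^ 2 * ‖S w‖ ^ 2 := by
        rw [norm_add_sq_real, real_inner_smul_right, norm_smul, Real.norm_of_nonneg hρ.le]
        ring
    _ ≤ ‖w‖ ^ 2 + 2 * ρ * -(s * ‖w‖ ^ 2) + ρ ^ 2 * (‖S‖ * ‖w‖) ^ 2 := by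
        gcongr
        · exact hS w
        · exact S.le_opNorm w
    _ ≤ ‖w‖ ^ 2 + 2 * ρ * -(s * ‖w‖ ^ 2) + ρ * (ρ * D) * ‖w‖ ^ 2 := by
        rw [hD]
        nlinarith [sq_nonneg (ρ * s * ‖w‖)]
    _ ≤ ((1 - ρ * s / 2) * ‖w‖) ^ 2 := by
        rw [hρD]
        nlinarith [sq_nonneg (ρ * s * ‖w‖)]

lemma exists_fixedPoint_closedBall {X : Type*} [MetricSpace X] [CompleteSpace X] {T : X → X}
    {x₀ : X} {δ q : ℝ} (hδ : 0 ≤ δ) (hq : 0 < q) (hq1 : q < 1)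
    (hT : ∀ x ∈ Metric.closedBall x₀ δ, ∀ y ∈ Metric.closedBall x₀ δ,
      dist (T x) (T y) ≤ (1 - q) * dist x y) (h₀ : dist (T x₀) x₀ ≤ q * δ) :
    ∃ x ∈ Metric.closedBall x₀ δ, T x = x := by
  have hx₀ : x₀ ∈ Metric.closedBall x₀ δ := Metric.mem_closedBall_self hδ
  have hmaps : MapsTo T (Metric.closedBall x₀ δ) (Metric.closedBall x₀ δ) := fun x hx =>
    calc dist (T x) x₀ ≤ (1 - q) * dist x x₀ + q * δ :=
          (dist_triangle _ _ _).trans (add_le_add (hT x hx x₀ hx₀) h₀)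
      _ ≤ (1 - q) * δ + q * δ := by gcongr; exact hx
      _ = δ := by ring
  lift 1 - q to NNReal using by linarith with k hk
  have hcontr : ContractingWith k (hmaps.restrict T _ _) :=
    ⟨by rw [← NNReal.coe_lt_coe, hk]; simpa using hq,
      LipschitzWith.of_dist_le_mul fun x y => hT x x.2 y y.2⟩
  obtain ⟨x, hx, hfix, -⟩ := ContractingWith.exists_fixedPoint'
    Metric.isClosed_closedBall.isComplete hmaps hcontr hx₀ (edist_ne_top _ _)
  exact ⟨x, hx, hfix⟩

/-- Forward-backward splitting: the variational inequality `c ∈ normalCone K v` is a fixed-point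
equation for the projection `π` onto `K`. -/
lemma projection_add_smul_eq_self_iff {π : F → F} (hπ : ∀ u, π u ∈ K)
    (hπnormal : ∀ u, u - π u ∈ normalCone K (π u)) {v c : F} {ρ : ℝ} (hρ : 0 < ρ) :
    π (v + ρ • c) = v ↔ v ∈ K ∧ c ∈ normalCone K v := by
  constructor
  · intro hfix
    have hnormal := hπnormal (v + ρ • c)
    rw [hfix, add_sub_cancel_left, smul_mem_normalCone_iff hρ] at hnormal
    exact ⟨hfix ▸ hπ _, hnormal⟩
  · rintro ⟨hv, hc⟩
    have hnormal : (v + ρ • c) - v ∈ normalCone K v := by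
      rwa [add_sub_cancel_left, smul_mem_normalCone_iff hρ]
    have hle := norm_sub_le_of_sub_mem_normalCone (hπ (v + ρ • c)) hv
      (hπnormal (v + ρ • c)) hnormal
    rwa [sub_self, norm_zero, norm_le_zero_iff, sub_eq_zero] at hle

variable {R : Type*} [NormedAddCommGroup R] [NormedSpace ℝ R] {Φ : F × R → F}
  {Φ' : F × R →L[ℝ] F} {v₀ : F} {ξ₀ : R} {s : ℝ}

lemma exists_forwardStep_contracting (hΦ : HasStrictFDerivAt Φ Φ' (v₀, ξ₀)) (hs : 0 < s)
    (hΦ' : ∀ w, ⟪w, Φ' (w, 0)⟫_ℝ ≤ -(s * ‖w‖ ^ 2)) :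
    ∃ ρ > (0 : ℝ), ∃ q > 0, q < 1 ∧ ∃ W ∈ 𝓝 (v₀, ξ₀), ∀ v v' ξ, (v, ξ) ∈ W → (v', ξ) ∈ W →
      ‖(v + ρ • Φ (v, ξ)) - (v' + ρ • Φ (v', ξ))‖ ≤ (1 - q) * ‖v - v'‖ := by
  obtain ⟨ρ, hρ, q, hq, hq1, hstep⟩ :=
    exists_norm_add_smul_le (Φ' ∘L .inl ℝ F R) hs fun w => by simpa using hΦ' w
  obtain ⟨ε, hε⟩ : ∃ ε : NNReal, ε = q / 2 / ρ := ⟨⟨q / 2 / ρ, by positivity⟩, rfl⟩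
  obtain ⟨W, hW, happrox⟩ := hΦ.approximates_deriv_on_nhds (c := ε)
    (Or.inr (by rw [← NNReal.coe_pos, hε]; positivity))
  refine ⟨ρ, hρ, q / 2, half_pos hq, by linarith, W, hW, fun v v' ξ hv hv' => ?_⟩
  have hdiff := happrox _ hv _ hv'
  rw [Prod.mk_sub_mk, sub_self] at hdiff
  calc ‖(v + ρ • Φ (v, ξ)) - (v' + ρ • Φ (v', ξ))‖
      = ‖(v - v' + ρ • Φ' (v - v', 0)) +
          ρ • (Φ (v, ξ) - Φ (v', ξ) - Φ' (v - v', 0))‖ := by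
        congr 1
        module
    _ ≤ (1 - q) * ‖v - v'‖ + ρ * (ε * ‖v - v'‖) := by
        refine (norm_add_le _ _).trans (add_le_add ?_ ?_)
        · simpa using hstep (v - v')
        · rw [norm_smul, Real.norm_of_nonneg hρ.le]
          gcongr
          simpa [Prod.norm_def] using hdiff
    _ = (1 - q / 2) * ‖v - v'‖ := by
        rw [hε, ← mul_assoc, mul_div_cancel₀ _ hρ.ne']
        ring

theorem eventually_exists_mem_normalCone [CompleteSpace F] (hclosed : IsClosed K)
    (hconv : Convex ℝ K) (hΦ : HasStrictFDerivAt Φ Φ' (v₀, ξ₀)) (hs : 0 < s)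
    (hΦ' : ∀ w, ⟪w, Φ' (w, 0)⟫_ℝ ≤ -(s * ‖w‖ ^ 2)) (hv₀ : v₀ ∈ K)
    (h₀ : Φ (v₀, ξ₀) ∈ normalCone K v₀) {U : Set (F × R)} (hU : U ∈ 𝓝 (v₀, ξ₀)) :
    ∀ᶠ ξ in 𝓝 ξ₀, ∃ v ∈ K, (v, ξ) ∈ U ∧ Φ (v, ξ) ∈ normalCone K v := by
  obtain ⟨ρ, hρ, q, hq, hq1, W, hW, hcontr⟩ := exists_forwardStep_contracting hΦ hs hΦ'
  choose π hπ hπnormal using exists_sub_mem_normalCone ⟨v₀, hv₀⟩ hclosed hconv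
  have hπ_nonexpansive : ∀ u u', ‖π u - π u'‖ ≤ ‖u - u'‖ := fun u u' =>
    norm_sub_le_of_sub_mem_normalCone (hπ u) (hπ u') (hπnormal u) (hπnormal u')
  let T : R → F → F := fun ξ v => π (v + ρ • Φ (v, ξ))
  have hsolves : ∀ {v ξ}, T ξ v = v ↔ v ∈ K ∧ Φ (v, ξ) ∈ normalCone K v :=
    projection_add_smul_eq_self_iff hπ hπnormal hρ
  have hmove : ∀ ξ, dist (T ξ v₀) v₀ ≤ ρ * ‖Φ (v₀, ξ) - Φ (v₀, ξ₀)‖ := fun ξ =>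
    calc dist (T ξ v₀) v₀ = ‖T ξ v₀ - T ξ₀ v₀‖ := by rw [hsolves.2 ⟨hv₀, h₀⟩, dist_eq_norm]
      _ ≤ ‖(v₀ + ρ • Φ (v₀, ξ)) - (v₀ + ρ • Φ (v₀, ξ₀))‖ := hπ_nonexpansive _ _
      _ = ρ * ‖Φ (v₀, ξ) - Φ (v₀, ξ₀)‖ := by
        rw [add_sub_add_left_eq_sub, ← smul_sub, norm_smul, Real.norm_of_nonneg hρ.le]
  obtain ⟨pv, hpv, pξ, hpξ, hWU⟩ := eventually_prod_iff.1
    (nhds_prod_eq (X := F) (Y := R) ▸ inter_mem hW hU : ∀ᶠ z in 𝓝 v₀ ×ˢ 𝓝 ξ₀, z ∈ W ∩ U)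
  obtain ⟨δ, hδ, hball⟩ := Metric.nhds_basis_closedBall.eventually_iff.1 hpv
  have hsmall : ∀ᶠ ξ in 𝓝 ξ₀, ρ * ‖Φ (v₀, ξ) - Φ (v₀, ξ₀)‖ ≤ q * δ := by
    have hcont : ContinuousAt (fun ξ => Φ (v₀, ξ)) ξ₀ :=
      ContinuousAt.comp (f := fun ξ => (v₀, ξ)) hΦ.continuousAt (by fun_prop)
    have hlim : Tendsto (fun ξ => ρ * ‖Φ (v₀, ξ) - Φ (v₀, ξ₀)‖) (𝓝 ξ₀) (𝓝 0) := by
      simpa using ((hcont.tendsto.sub_const (Φ (v₀, ξ₀))).norm.const_mul ρ)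
    exact hlim.eventually_le_const (by positivity)
  filter_upwards [hsmall, hpξ] with ξ hξ hpξ
  obtain ⟨v, hv, hfix⟩ := exists_fixedPoint_closedBall (T := T ξ) hδ.le hq hq1
    (fun v hv v' hv' => by
      rw [dist_eq_norm, dist_eq_norm]
      exact (hπ_nonexpansive _ _).trans
        (hcontr v v' ξ (hWU (hball hv) hpξ).1 (hWU (hball hv') hpξ).1))
    ((hmove ξ).trans hξ)
  exact ⟨v, (hsolves.1 hfix).1, (hWU (hball hv) hpξ).2, (hsolves.1 hfix).2⟩

end NormalCone

section Existence

lemma exists_implicit_map {𝕜 Z E : Type*} [NontriviallyNormedField 𝕜] [NormedAddCommGroup Z]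
    [NormedSpace 𝕜 Z] [CompleteSpace Z] [NormedAddCommGroup E] [NormedSpace 𝕜 E] [CompleteSpace E]
    {Ψ : Z × E → E} {M : Z →L[𝕜] E} {A : E ≃L[𝕜] E} {z₀ : Z} {x₀ : E}
    (hΨ : HasStrictFDerivAt Ψ (M.coprod (A : E →L[𝕜] E)) (z₀, x₀)) (h₀ : Ψ (z₀, x₀) = 0) :
    ∃ (X : Z → E) (X' : Z →L[𝕜] E), X z₀ = x₀ ∧ HasStrictFDerivAt X X' z₀ ∧
      (∀ w, A (X' w) = -M w) ∧ ∀ᶠ z in 𝓝 z₀, Ψ (z, X z) = 0 := by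
  have hinr : M.coprod (A : E →L[𝕜] E) ∘L .inr 𝕜 Z E = A := by ext; simp
  have hinv : (M.coprod (A : E →L[𝕜] E) ∘L .inr 𝕜 Z E).IsInvertible := ⟨A, hinr.symm⟩
  refine ⟨hΨ.implicitFunctionOfProdDomain hinv, _, ?_,
    hΨ.hasStrictFDerivAt_implicitFunctionOfProdDomain hinv, fun w => ?_, ?_⟩
  · exact (hΨ.eventually_apply_eq_iff_implicitFunctionOfProdDomain hinv).self_of_nhds.1 rfl
  · rw [hinr, ContinuousLinearMap.inverse_equiv]
    simp
  · exact h₀ ▸ hΨ.eventually_apply_implicitFunctionOfProdDomain hinv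

variable {E F R : Type*} [NormedAddCommGroup E] [InnerProductSpace ℝ E] [CompleteSpace E]
  [NormedAddCommGroup F] [InnerProductSpace ℝ F] [CompleteSpace F]
  [NormedAddCommGroup R] [NormedSpace ℝ R] [CompleteSpace R]
  {A : E →L[ℝ] E} {B : E →L[ℝ] F} {L : R →L[ℝ] E} {G : R →L[ℝ] F} {a b σ : ℝ}

namespace HasSaddleBounds

lemma inner_apply_le_of_apply_eq_neg_adjoint (h : HasSaddleBounds A B a b σ) {q : E} {w : F}
    (hq : A q = -adjoint B w) : ⟪w, B q⟫_ℝ ≤ -(σ ^ 2 / b * ‖w‖ ^ 2) := by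
  have hinner : ⟪w, B q⟫_ℝ = -energyNorm A q ^ 2 := by
    rw [h.sq_energyNorm, hq, inner_neg_right, neg_neg, ContinuousLinearMap.adjoint_inner_right,
      real_inner_comm]
  have hnorm : σ * ‖w‖ ≤ √b * energyNorm A q := by
    rw [← norm_neg w]
    exact h.mul_norm_le_of_apply_eq_adjoint (by rw [hq, map_neg])
  have hsq := pow_le_pow_left₀ (mul_nonneg h.adjoint_pos.le (norm_nonneg w)) hnorm 2
  rw [mul_pow, mul_pow, Real.sq_sqrt h.upper_pos.le] at hsq
  rw [hinner, neg_le_neg_iff, div_mul_eq_mul_div, div_le_iff₀' h.upper_pos]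
  exact hsq

theorem eventually_exists_isPrimalDualSolution (h : HasSaddleBounds A B a b σ) {K : Set F}
    (hclosed : IsClosed K) (hconv : Convex ℝ K) {Ψ : (F × R) × E → E} {c : E × R → F}
    {x₀ : E} {v₀ : F} {ξ₀ : R}
    (hΨ : HasStrictFDerivAt Ψ (((adjoint B).coprod L).coprod A) ((v₀, ξ₀), x₀))
    (hc : HasStrictFDerivAt c (B.coprod G) (x₀, ξ₀)) (h₀ : IsPrimalDualSolution K Ψ c x₀ v₀ ξ₀)
    {W : Set ((F × R) × E)} (hW : W ∈ 𝓝 ((v₀, ξ₀), x₀)) :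
    ∀ᶠ ξ in 𝓝 ξ₀, ∃ x v, ((v, ξ), x) ∈ W ∧ IsPrimalDualSolution K Ψ c x v ξ := by
  obtain ⟨A, rfl⟩ := exists_continuousLinearEquiv_of_coercive h.lower_pos h.lower
  obtain ⟨X, X', rfl, hX, hX', hstat⟩ := exists_implicit_map hΨ h₀.stationary
  have hΦ : HasStrictFDerivAt (fun z => c (X z, z.2)) (B.coprod G ∘L X'.prod (.snd ℝ F R))
      (v₀, ξ₀) := hc.comp (v₀, ξ₀) (hX.prodMk hasStrictFDerivAt_snd)
  have hdissipative : ∀ w, ⟪w, (B.coprod G ∘L X'.prod (.snd ℝ F R)) (w, 0)⟫_ℝ ≤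
      -(σ ^ 2 / b * ‖w‖ ^ 2) := fun w => by
    have hw : A (X' (w, 0)) = -adjoint B w := by simp [hX']
    simpa using h.inner_apply_le_of_apply_eq_neg_adjoint hw
  have hgraph : ∀ᶠ z in 𝓝 (v₀, ξ₀), (z, X z) ∈ W :=
    (continuousAt_id.prodMk hX.continuousAt) hW
  have hs : 0 < σ ^ 2 / b := div_pos (pow_pos h.adjoint_pos 2) h.upper_pos
  filter_upwards [eventually_exists_mem_normalCone hclosed hconv hΦ hs hdissipative h₀.mem
    h₀.mem_normalCone (hstat.and hgraph)] with ξ ⟨v, hv, ⟨hstat, hmem⟩, hnormal⟩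
  exact ⟨X (v, ξ), v, hmem, hv, hstat, hnormal⟩

theorem exists_continuousOn_isPrimalDualSolution (h : HasSaddleBounds A B a b σ) {K : Set F}
    (hclosed : IsClosed K) (hconv : Convex ℝ K) {Ψ : (F × R) × E → E} {c : E × R → F}
    {x₀ : E} {v₀ : F} {ξ₀ : R}
    (hΨ : HasStrictFDerivAt Ψ (((adjoint B).coprod L).coprod A) ((v₀, ξ₀), x₀))
    (hc : HasStrictFDerivAt c (B.coprod G) (x₀, ξ₀)) (h₀ : IsPrimalDualSolution K Ψ c x₀ v₀ ξ₀)
    {W : Set ((F × R) × E)} (hW : W ∈ 𝓝 ((v₀, ξ₀), x₀)) :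
    ∃ N ∈ 𝓝 ξ₀, ∃ (X : R → E) (V : R → F), ContinuousOn X N ∧ ContinuousOn V N ∧
      X ξ₀ = x₀ ∧ V ξ₀ = v₀ ∧
        ∀ ξ ∈ N, ((V ξ, ξ), X ξ) ∈ W ∧ IsPrimalDualSolution K Ψ c (X ξ) (V ξ) ξ := by
  obtain ⟨W', hW', hlip⟩ := h.exists_nhds_forall_norm_sub_le (K := K) hΨ hc
    (lt_add_one _) (lt_add_one _)
  obtain ⟨N, hN, hsolvable⟩ := (h.eventually_exists_isPrimalDualSolution hclosed hconv hΨ hc h₀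
    (inter_mem hW hW')).exists_mem
  choose! X V hmem hsol using hsolvable
  have hbound : ∀ ξ ∈ N, ∀ ξ' ∈ N, ‖X ξ - X ξ'‖ ≤ _ ∧ ‖V ξ - V ξ'‖ ≤ _ := fun ξ hξ ξ' hξ' =>
    hlip _ _ _ _ _ _ (hmem ξ hξ).2 (hmem ξ' hξ').2 (hsol ξ hξ) (hsol ξ' hξ')
  have hbase := hlip _ _ _ _ _ _ (hmem ξ₀ (mem_of_mem_nhds hN)).2 (mem_of_mem_nhds hW')
    (hsol ξ₀ (mem_of_mem_nhds hN)) h₀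
  simp only [sub_self, norm_zero, mul_zero, norm_le_zero_iff, sub_eq_zero] at hbase
  refine ⟨N, hN, X, V, ?_, ?_, hbase.1, hbase.2, fun ξ hξ => ⟨(hmem ξ hξ).1, hsol ξ hξ⟩⟩
  · exact (LipschitzOnWith.of_dist_le' fun ξ hξ ξ' hξ' => by
      simpa only [dist_eq_norm] using (hbound ξ hξ ξ' hξ').1).continuousOn
  · exact (LipschitzOnWith.of_dist_le' fun ξ hξ ξ' hξ' => by
      simpa only [dist_eq_norm] using (hbound ξ hξ ξ' hξ').2).continuousOn

end HasSaddleBounds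

end Existence

section Calculus

variable {X Y Z : Type*} [NormedAddCommGroup X] [NormedSpace ℝ X] [NormedAddCommGroup Y]
  [NormedSpace ℝ Y] [NormedAddCommGroup Z] [NormedSpace ℝ Z]

lemma hasStrictFDerivAt_coprod_fderiv {f : X × Y → Z} {x : X} {y : Y} {f' : X × Y →L[ℝ] Z}
    (hf : HasStrictFDerivAt f f' (x, y)) :
    HasStrictFDerivAt f
      ((fderiv ℝ (fun a => f (a, y)) x).coprod (fderiv ℝ (fun b => f (x, b)) y)) (x, y) := by
  have hx : fderiv ℝ (fun a => f (a, y)) x = f' ∘L .inl ℝ X Y :=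
    (HasFDerivAt.comp (f := fun a => (a, y)) x hf.hasFDerivAt (hasFDerivAt_prodMk_left x y)).fderiv
  have hy : fderiv ℝ (fun b => f (x, b)) y = f' ∘L .inr ℝ X Y :=
    (hf.hasFDerivAt.comp y (hasFDerivAt_prodMk_right x y)).fderiv
  rwa [hx, hy, ContinuousLinearMap.coprod_comp_inl_inr]

variable {E : Type*} [NormedAddCommGroup E] [InnerProductSpace ℝ E]

lemma eventually_coercive {A : E →L[ℝ] E} {a a' : ℝ} (haa' : a' < a)
    (hA : ∀ y, a * ‖y‖ ^ 2 ≤ ⟪y, A y⟫_ℝ) : ∀ᶠ A' in 𝓝 A, ∀ y, a' * ‖y‖ ^ 2 ≤ ⟪y, A' y⟫_ℝ := by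
  filter_upwards [Metric.ball_mem_nhds A (sub_pos.2 haa')] with A' hA' y
  rw [Metric.mem_ball', dist_eq_norm] at hA'
  have herror : ⟪y, (A - A') y⟫_ℝ ≤ (a - a') * ‖y‖ ^ 2 :=
    calc ⟪y, (A - A') y⟫_ℝ ≤ ‖y‖ * ‖(A - A') y‖ := real_inner_le_norm _ _
      _ ≤ ‖y‖ * ((a - a') * ‖y‖) := by
        gcongr
        exact (A - A').le_of_opNorm_le hA'.le y
      _ = (a - a') * ‖y‖ ^ 2 := by ring
  rw [sub_apply, inner_sub_right] at herror
  linarith [hA y]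

variable [CompleteSpace E]

lemma hasGradientAt_inner_left_const {F : Type*} [NormedAddCommGroup F] [InnerProductSpace ℝ F]
    [CompleteSpace F] {c : E → F} {c' : E →L[ℝ] F} {x : E} (hc : HasFDerivAt c c' x) (v : F) :
    HasGradientAt (fun y => ⟪v, c y⟫_ℝ) (adjoint c' v) x := by
  rw [hasGradientAt_iff_hasFDerivAt]
  refine ((innerSL ℝ v).hasFDerivAt.comp x hc).congr_fderiv (ContinuousLinearMap.ext fun y => ?_)
  exact (ContinuousLinearMap.adjoint_inner_left c' y v).symm

lemma inner_fderiv_gradient (f : E → ℝ) (x y z : E) :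
    ⟪fderiv ℝ (gradient f) x y, z⟫_ℝ = fderiv ℝ (fderiv ℝ f) x y z := by
  have hgradient : gradient f =
      (InnerProductSpace.toDual ℝ E).symm.toContinuousLinearEquiv ∘ fderiv ℝ f := rfl
  rw [hgradient, ContinuousLinearEquiv.comp_fderiv]
  exact InnerProductSpace.toDual_symm_apply

lemma isSymmetric_fderiv_gradient {f : E → ℝ} {x : E} (hf : ContDiffAt ℝ 2 f x) :
    (fderiv ℝ (gradient f) x).toLinearMap.IsSymmetric := fun y z => by
  have hsymm : IsSymmSndFDerivAt ℝ f x := hf.isSymmSndFDerivAt (by simp)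
  rw [ContinuousLinearMap.coe_coe, inner_fderiv_gradient, hsymm y z, ← inner_fderiv_gradient,
    real_inner_comm]

lemma contDiffAt_gradient_snd {f : X × E → ℝ} {z : X × E} (hf : ContDiffAt ℝ 2 f z) :
    ContDiffAt ℝ 1 (fun z : X × E => gradient (fun y => f (z.1, y)) z.2) z := by
  have hfderiv : ContDiffAt ℝ 1 (fun z : X × E => fderiv ℝ (fun y => f (z.1, y)) z.2) z :=
    ContDiffAt.fderiv (f := fun z y => f (z.1, y))
      (ContDiffAt.comp (z, z.2) hf (contDiffAt_fst.fst'.prodMk contDiffAt_snd)) contDiffAt_snd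
      (by norm_num)
  exact (InnerProductSpace.toDual ℝ E).symm.toContinuousLinearEquiv.contDiff.contDiffAt.comp z
    hfderiv

lemma contDiffAt_gradient {f : E → ℝ} {x : E} (hf : ContDiffAt ℝ 2 f x) :
    ContDiffAt ℝ 1 (gradient f) x :=
  (InnerProductSpace.toDual ℝ E).symm.toContinuousLinearEquiv.contDiff.contDiffAt.comp x
    (hf.fderiv_right (m := 1) (by norm_num))

lemma isLocalMin_of_eventually_inner_gradient_nonneg {f : E → ℝ} {x : E}
    (hdiff : ∀ᶠ y in 𝓝 x, DifferentiableAt ℝ f y)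
    (hgrad : ∀ᶠ y in 𝓝 x, 0 ≤ ⟪gradient f y, y - x⟫_ℝ) : IsLocalMin f x := by
  obtain ⟨δ, hδ, hball⟩ := Metric.eventually_nhds_iff_ball.1 (hdiff.and hgrad)
  filter_upwards [Metric.ball_mem_nhds x hδ] with y hy
  have hsegment : ∀ t ∈ Icc (0 : ℝ) 1, x + t • (y - x) ∈ Metric.ball x δ := fun t ht =>
    (convex_ball x δ).add_smul_sub_mem (Metric.mem_ball_self hδ) hy ht
  have hderiv : ∀ t ∈ Icc (0 : ℝ) 1, HasDerivAt (fun t : ℝ => f (x + t • (y - x)))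
      ⟪gradient f (x + t • (y - x)), y - x⟫_ℝ t := fun t ht => by
    have hline : HasDerivAt (fun t : ℝ => x + t • (y - x)) (y - x) t := by
      simpa using ((hasDerivAt_id t).smul_const (y - x)).const_add x
    rw [inner_gradient_left]
    exact (hball _ (hsegment t ht)).1.hasFDerivAt.comp_hasDerivAt t hline
  obtain ⟨t, ht, hslope⟩ := exists_hasDerivAt_eq_slope _ _ one_pos
    (fun t ht => (hderiv t ht).continuousAt.continuousWithinAt)
    (fun t ht => hderiv t (Ioo_subset_Icc_self ht))
  have hnonneg := (hball _ (hsegment t (Ioo_subset_Icc_self ht))).2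
  rw [add_sub_cancel_left, real_inner_smul_right] at hnonneg
  have := nonneg_of_mul_nonneg_right hnonneg ht.1
  simpa [hslope] using this

lemma isLocalMin_of_gradient_eq_zero {f : E → ℝ} {x : E} {a : ℝ} (hf : ContDiffAt ℝ 2 f x)
    (h0 : gradient f x = 0) (ha : 0 < a)
    (hpos : ∀ y, a * ‖y‖ ^ 2 ≤ ⟪y, fderiv ℝ (gradient f) x y⟫_ℝ) : IsLocalMin f x := by
  refine isLocalMin_of_eventually_inner_gradient_nonneg
    ((hf.eventually (by simp)).mono fun y hy => hy.differentiableAt (by norm_num)) ?_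
  have hderiv := ((contDiffAt_gradient hf).differentiableAt (by norm_num)).hasFDerivAt
  filter_upwards [hderiv.isLittleO.def ha] with y hy
  rw [h0, sub_zero] at hy
  set H := fderiv ℝ (gradient f) x
  have herror : -(a * ‖y - x‖ * ‖y - x‖) ≤ ⟪gradient f y - H (y - x), y - x⟫_ℝ :=
    calc -(a * ‖y - x‖ * ‖y - x‖) ≤ -(‖gradient f y - H (y - x)‖ * ‖y - x‖) := by gcongr
      _ ≤ _ := neg_le_of_abs_le (abs_real_inner_le_norm _ _)
  rw [inner_sub_left, real_inner_comm _ (H (y - x))] at herror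
  linarith [hpos (y - x)]

end Calculus

section EuclideanOperators

lemma linearIndependent_apply_single_iff {M : Type*} [AddCommGroup M] [Module ℝ M] {κ : Type*}
    [Finite κ] [DecidableEq κ] (T : EuclideanSpace ℝ κ →ₗ[ℝ] M) :
    LinearIndependent ℝ (fun k => T (EuclideanSpace.single k 1)) ↔ Function.Injective T := by
  have := Fintype.ofFinite κ
  have hcombination : ⇑(Fintype.linearCombination ℝ fun k => T (EuclideanSpace.single k 1)) =
      T ∘ (WithLp.linearEquiv 2 ℝ (κ → ℝ)).symm := by
    funext c
    rw [Fintype.linearCombination_apply, Function.comp_apply,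
      ← (EuclideanSpace.basisFun κ ℝ).sum_repr ((WithLp.linearEquiv 2 ℝ (κ → ℝ)).symm c), map_sum]
    simp
  rw [linearIndependent_iff_injective_fintypeLinearCombination, hcombination]
  exact Function.Injective.of_comp_iff' T (WithLp.linearEquiv 2 ℝ (κ → ℝ)).symm.bijective

variable {V : Type*} [NormedAddCommGroup V] [InnerProductSpace ℝ V] [FiniteDimensional ℝ V]
  {T : V →ₗ[ℝ] V} {d : ℕ}

lemma inner_apply_self_eq_sum_eigenvalues (hT : T.IsSymmetric) (hd : Module.finrank ℝ V = d)
    (v : V) :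
    ⟪v, T v⟫_ℝ = ∑ i, hT.eigenvalues hd i * ‖⟪hT.eigenvectorBasis hd i, v⟫_ℝ‖ ^ 2 := by
  rw [← (hT.eigenvectorBasis hd).sum_inner_mul_inner v (T v)]
  refine Finset.sum_congr rfl fun i _ => ?_
  rw [← hT, hT.apply_eigenvectorBasis, real_inner_smul_left, real_inner_comm, Real.norm_eq_abs,
    sq_abs, RCLike.ofReal_real_eq_id, id]
  ring

lemma mul_sq_norm_le_inner_apply_self (hT : T.IsSymmetric) (hd : Module.finrank ℝ V = d) {a : ℝ}
    (ha : ∀ i, a ≤ hT.eigenvalues hd i) (v : V) : a * ‖v‖ ^ 2 ≤ ⟪v, T v⟫_ℝ := by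
  rw [inner_apply_self_eq_sum_eigenvalues hT hd,
    ← (hT.eigenvectorBasis hd).sum_sq_norm_inner_right v, Finset.mul_sum]
  gcongr with i
  exact ha i

lemma inner_apply_self_le_mul_sq_norm (hT : T.IsSymmetric) (hd : Module.finrank ℝ V = d) {b : ℝ}
    (hb : ∀ i, hT.eigenvalues hd i ≤ b) (v : V) : ⟪v, T v⟫_ℝ ≤ b * ‖v‖ ^ 2 := by
  rw [inner_apply_self_eq_sum_eigenvalues hT hd,
    ← (hT.eigenvectorBasis hd).sum_sq_norm_inner_right v, Finset.mul_sum]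
  gcongr with i
  exact hb i

variable {n : ℕ} {A : EuclideanSpace ℝ (Fin n) →L[ℝ] EuclideanSpace ℝ (Fin n)}

lemma lamMin_mul_sq_norm_le (hA : A.toLinearMap.IsSymmetric) (y : EuclideanSpace ℝ (Fin n)) :
    lamMin A * ‖y‖ ^ 2 ≤ ⟪y, A y⟫_ℝ :=
  mul_sq_norm_le_inner_apply_self hA finrank_euclideanSpace_fin (fun i =>
    csInf_le (Module.End.finite_hasEigenvalue _).bddBelow (hA.hasEigenvalue_eigenvalues _ i)) y

lemma inner_le_lamMax_mul_sq_norm (hA : A.toLinearMap.IsSymmetric)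
    (y : EuclideanSpace ℝ (Fin n)) : ⟪y, A y⟫_ℝ ≤ lamMax A * ‖y‖ ^ 2 :=
  inner_apply_self_le_mul_sq_norm hA finrank_euclideanSpace_fin (fun i =>
    le_csSup (Module.End.finite_hasEigenvalue _).bddAbove (hA.hasEigenvalue_eigenvalues _ i)) y

lemma hasEigenvalue_lamMin [Nontrivial (EuclideanSpace ℝ (Fin n))]
    (hA : A.toLinearMap.IsSymmetric) : Module.End.HasEigenvalue A.toLinearMap (lamMin A) :=
  Nonempty.csInf_mem ⟨_, hA.hasEigenvalue_iInf_of_finiteDimensional⟩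
    (Module.End.finite_hasEigenvalue _)

lemma lamMin_pos [Nontrivial (EuclideanSpace ℝ (Fin n))] (hA : A.toLinearMap.IsSymmetric)
    (hpos : ∀ y, y ≠ 0 → 0 < ⟪y, A y⟫_ℝ) : 0 < lamMin A := by
  obtain ⟨y, hy⟩ := (hasEigenvalue_lamMin hA).exists_hasEigenvector
  have hinner := hpos y hy.2
  have happly : A y = lamMin A • y := hy.apply_eq_smul
  rw [happly, real_inner_smul_right] at hinner
  exact pos_of_mul_pos_left hinner real_inner_self_nonneg

lemma lamMin_le_lamMax [Nontrivial (EuclideanSpace ℝ (Fin n))] (hA : A.toLinearMap.IsSymmetric) :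
    lamMin A ≤ lamMax A :=
  le_csSup (Module.End.finite_hasEigenvalue _).bddAbove (hasEigenvalue_lamMin hA)

variable {ι κ : Type*} [Fintype ι] [Fintype κ]
  {T : EuclideanSpace ℝ ι →L[ℝ] EuclideanSpace ℝ κ}

lemma sigmaMin_eq_of_injective (hT : Function.Injective T) :
    sigmaMin T = T.toLinearMap.singularValues (Fintype.card ι - 1) := by
  have hcard := LinearMap.finrank_le_finrank_of_injective (f := T.toLinearMap) hT
  simp only [finrank_euclideanSpace] at hcard
  rw [sigmaMin, min_eq_left hcard]

lemma sigmaMin_pos [Nonempty ι] (hT : Function.Injective T) : 0 < sigmaMin T := by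
  rw [sigmaMin_eq_of_injective hT]
  refine T.toLinearMap.injective_iff_forall_lt_finrank_singularValues_pos.1 hT _ ?_
  rw [finrank_euclideanSpace]
  exact Nat.sub_lt Fintype.card_pos one_pos

lemma sigmaMin_mul_norm_le [Nonempty ι] (hT : Function.Injective T) (v : EuclideanSpace ℝ ι) :
    sigmaMin T * ‖v‖ ≤ ‖T v‖ := by
  have hlast : Fintype.card ι - 1 < Fintype.card ι := Nat.sub_lt Fintype.card_pos one_pos
  have hrank : Module.finrank ℝ (EuclideanSpace ℝ ι) = Fintype.card ι := finrank_euclideanSpace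
  have hsymm := T.toLinearMap.isSymmetric_adjoint_comp_self
  have hle : ∀ i, sigmaMin T ^ 2 ≤ hsymm.eigenvalues hrank i := fun i => by
    rw [sigmaMin_eq_of_injective hT, T.toLinearMap.sq_singularValues_of_lt hrank hlast]
    exact hsymm.eigenvalues_antitone hrank (Fin.le_def.2 (Nat.le_sub_one_of_lt i.2))
  refine le_of_sq_le_sq ?_ (norm_nonneg _)
  calc (sigmaMin T * ‖v‖) ^ 2 = sigmaMin T ^ 2 * ‖v‖ ^ 2 := mul_pow _ _ _
    _ ≤ ⟪v, (T.toLinearMap.adjoint ∘ₗ T.toLinearMap) v⟫_ℝ :=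
      mul_sq_norm_le_inner_apply_self hsymm hrank hle v
    _ = ‖T v‖ ^ 2 := by
      rw [LinearMap.comp_apply, LinearMap.adjoint_inner_right, real_inner_self_eq_norm_sq]
      rfl

section SaddleBounds

variable [Nontrivial (EuclideanSpace ℝ (Fin n))]
  {B : EuclideanSpace ℝ (Fin n) →L[ℝ] EuclideanSpace ℝ ι}

lemma hasSaddleBounds_lamMin_lamMax (hA : A.toLinearMap.IsSymmetric)
    (hpos : ∀ y, y ≠ 0 → 0 < ⟪y, A y⟫_ℝ) {σ : ℝ} (hσ : 0 < σ)
    (hB : ∀ v, σ * ‖v‖ ≤ ‖adjoint B v‖) : HasSaddleBounds A B (lamMin A) (lamMax A) σ where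
  isSymmetric := hA
  lower_pos := lamMin_pos hA hpos
  lower_le_upper := lamMin_le_lamMax hA
  lower := lamMin_mul_sq_norm_le hA
  upper := inner_le_lamMax_mul_sq_norm hA
  adjoint_pos := hσ
  adjoint_lower := hB

end SaddleBounds

end EuclideanOperators

namespace ParamNLP

section Multipliers

variable {p m : ℕ} {S : Finset (Fin m)}

/-- The multipliers of the equality constraints and of the inequality constraints in `S`, stacked
in the order of `ParamNLP.constr`. -/
def stackMultipliers (S : Finset (Fin m)) (l : EuclideanSpace ℝ (Fin p))
    (u : EuclideanSpace ℝ (Fin m)) : EuclideanSpace ℝ (Fin p ⊕ S) :=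
  WithLp.toLp 2 (Sum.elim (fun j => l j) (fun i => u i))

/-- The equality part of a stacked multiplier. -/
def eqMultiplier (v : EuclideanSpace ℝ (Fin p ⊕ S)) : EuclideanSpace ℝ (Fin p) :=
  WithLp.toLp 2 fun j => v (.inl j)

/-- The inequality part of a stacked multiplier, extended by zero outside `S`. -/
def ineqMultiplier (v : EuclideanSpace ℝ (Fin p ⊕ S)) : EuclideanSpace ℝ (Fin m) :=
  WithLp.toLp 2 fun i => if hi : i ∈ S then v (.inr ⟨i, hi⟩) else 0

/-- The cone of stacked multipliers whose inequality part is nonnegative. -/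
def multiplierCone (p : ℕ) (S : Finset (Fin m)) : Set (EuclideanSpace ℝ (Fin p ⊕ S)) :=
  {v | ∀ i : S, 0 ≤ v (.inr i)}

lemma eqMultiplier_stackMultipliers (l : EuclideanSpace ℝ (Fin p))
    (u : EuclideanSpace ℝ (Fin m)) : eqMultiplier (stackMultipliers S l u) = l :=
  rfl

lemma ineqMultiplier_stackMultipliers {l : EuclideanSpace ℝ (Fin p)}
    {u : EuclideanSpace ℝ (Fin m)} (hu : ∀ i ∉ S, u i = 0) :
    ineqMultiplier (stackMultipliers S l u) = u := by
  ext i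
  by_cases hi : i ∈ S
  · simp [ineqMultiplier, stackMultipliers, hi]
  · simp [ineqMultiplier, hi, hu i hi]

lemma stackMultipliers_eqMultiplier_ineqMultiplier (v : EuclideanSpace ℝ (Fin p ⊕ S)) :
    stackMultipliers S (eqMultiplier v) (ineqMultiplier v) = v := by
  ext (j | i) <;> simp [stackMultipliers, eqMultiplier, ineqMultiplier]

lemma continuous_stackMultipliers :
    Continuous fun w : EuclideanSpace ℝ (Fin p) × EuclideanSpace ℝ (Fin m) =>
      stackMultipliers S w.1 w.2 := by
  refine (PiLp.continuous_toLp 2 _).comp (continuous_pi ?_)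
  rintro (j | i)
  · simp only [Sum.elim_inl]
    fun_prop
  · simp only [Sum.elim_inr]
    fun_prop

lemma continuous_eqMultiplier :
    Continuous (eqMultiplier : EuclideanSpace ℝ (Fin p ⊕ S) → EuclideanSpace ℝ (Fin p)) :=
  (PiLp.continuous_toLp 2 _).comp (continuous_pi fun j => by fun_prop)

lemma continuous_ineqMultiplier :
    Continuous (ineqMultiplier : EuclideanSpace ℝ (Fin p ⊕ S) → EuclideanSpace ℝ (Fin m)) := by
  refine (PiLp.continuous_toLp 2 _).comp (continuous_pi fun i => ?_)
  by_cases hi : i ∈ S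
  · simp only [hi, dif_pos]
    fun_prop
  · simp only [hi, dif_neg, not_false_eq_true]
    fun_prop

lemma norm_toLp_sub_eq_norm_stackMultipliers_sub {l l' : EuclideanSpace ℝ (Fin p)}
    {u u' : EuclideanSpace ℝ (Fin m)} (hu : ∀ i ∉ S, u i = 0) (hu' : ∀ i ∉ S, u' i = 0) :
    ‖WithLp.toLp 2 (l, u) - WithLp.toLp 2 (l', u')‖ =
      ‖stackMultipliers S l u - stackMultipliers S l' u'‖ := by
  rw [← sq_eq_sq₀ (norm_nonneg _) (norm_nonneg _), WithLp.prod_norm_sq_eq_of_L2,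
    EuclideanSpace.norm_sq_eq, EuclideanSpace.norm_sq_eq, EuclideanSpace.norm_sq_eq,
    Fintype.sum_sum_type]
  congr 1
  rw [← Finset.sum_subset (Finset.subset_univ S), ← Finset.sum_coe_sort]
  · rfl
  · intro i _ hi
    simp [hu i hi, hu' i hi]

lemma isClosed_multiplierCone : IsClosed (multiplierCone p S) := by
  simp only [multiplierCone, ofPred_forall]
  exact isClosed_iInter fun i => isClosed_le continuous_const (by fun_prop)

lemma convex_multiplierCone : Convex ℝ (multiplierCone p S) :=
  fun _ hv _ hw _ _ hs ht _ i =>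
    add_nonneg (mul_nonneg hs (hv i)) (mul_nonneg ht (hw i))

lemma mul_apply_nonpos_of_mem_normalCone {v c : EuclideanSpace ℝ (Fin p ⊕ S)}
    (hc : c ∈ normalCone (multiplierCone p S) v) {k : Fin p ⊕ S} {t : ℝ}
    (hmem : v + EuclideanSpace.single k t ∈ multiplierCone p S) : t * c k ≤ 0 := by
  simpa [EuclideanSpace.inner_single_right] using hc _ hmem

lemma mem_normalCone_multiplierCone_iff {v c : EuclideanSpace ℝ (Fin p ⊕ S)}
    (hv : v ∈ multiplierCone p S) :
    c ∈ normalCone (multiplierCone p S) v ↔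
      (∀ j, c (.inl j) = 0) ∧ ∀ i, c (.inr i) ≤ 0 ∧ v (.inr i) * c (.inr i) = 0 := by
  constructor
  · refine fun hc => ⟨fun j => ?_, fun i => ?_⟩
    · have hsq := mul_apply_nonpos_of_mem_normalCone hc (k := .inl j) (t := c (.inl j))
        fun i => by simpa using hv i
      exact mul_self_eq_zero.1 (hsq.antisymm (mul_self_nonneg _))
    · have hstep : ∀ t, -v (.inr i) ≤ t → t * c (.inr i) ≤ 0 := fun t ht =>
        mul_apply_nonpos_of_mem_normalCone hc fun i' => by
          obtain rfl | hne := eq_or_ne i' i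
          · simpa using neg_le_iff_add_nonneg'.1 ht
          · simpa [hne] using hv i'
      have hnonpos : c (.inr i) ≤ 0 := by
        simpa using hstep 1 ((neg_nonpos.2 (hv i)).trans zero_le_one)
      refine ⟨hnonpos, (mul_nonpos_of_nonneg_of_nonpos (hv i) hnonpos).antisymm ?_⟩
      linarith [hstep _ le_rfl]
  · rintro ⟨heq, hineq⟩ w hw
    rw [PiLp.inner_apply, Fintype.sum_sum_type]
    refine add_nonpos (Finset.sum_nonpos fun j _ => by simp [heq j])
      (Finset.sum_nonpos fun i _ => ?_)
    have hprod := mul_nonpos_of_nonneg_of_nonpos (hw i) (hineq i).1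
    simp only [PiLp.sub_apply, RCLike.inner_apply, conj_trivial]
    linarith [(hineq i).2, sub_mul (w (.inr i)) (v (.inr i)) (c (.inr i))]

end Multipliers

section Reduction

variable {n p m r : ℕ} (P : ParamNLP n p m r)

/-- The gradient of the Lagrangian as a function of stacked multipliers, parameter and state. -/
noncomputable def reducedGradL (S : Finset (Fin m)) :
    (EuclideanSpace ℝ (Fin p ⊕ S) × EuclideanSpace ℝ (Fin r)) × EuclideanSpace ℝ (Fin n) →
      EuclideanSpace ℝ (Fin n) :=
  fun z => P.gradL z.2 (eqMultiplier z.1.1) (ineqMultiplier z.1.1) z.1.2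

/-- The constraints in the index set `S` as a function of state and parameter. -/
def reducedConstr (S : Finset (Fin m)) :
    EuclideanSpace ℝ (Fin n) × EuclideanSpace ℝ (Fin r) → EuclideanSpace ℝ (Fin p ⊕ S) :=
  fun z => P.constr S z.1 z.2

variable {P} {S : Finset (Fin m)} {x : EuclideanSpace ℝ (Fin n)} {l : EuclideanSpace ℝ (Fin p)}
  {u : EuclideanSpace ℝ (Fin m)} {v : EuclideanSpace ℝ (Fin p ⊕ S)}
  {ξ : EuclideanSpace ℝ (Fin r)}

lemma lagrangian_eq_add_inner_constr (x : EuclideanSpace ℝ (Fin n))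
    (v : EuclideanSpace ℝ (Fin p ⊕ S)) (ξ : EuclideanSpace ℝ (Fin r)) :
    P.lagrangian x (eqMultiplier v) (ineqMultiplier v) ξ =
      P.f x ξ + ⟪v, P.constr S x ξ⟫_ℝ := by
  rw [lagrangian, PiLp.inner_apply, Fintype.sum_sum_type, add_assoc]
  congr 2
  · refine Finset.sum_congr rfl fun j _ => ?_
    simp [eqMultiplier, constr, mul_comm]
  · rw [← Finset.sum_subset (Finset.subset_univ S), ← Finset.sum_coe_sort]
    · refine Finset.sum_congr rfl fun i _ => ?_
      simp [ineqMultiplier, constr, mul_comm]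
    · intro i _ hi
      simp [ineqMultiplier, hi]

lemma mem_active_iff {i : Fin m} : i ∈ P.active x ξ ↔ P.g x ξ i = 0 := by
  simp [active]

lemma lt_zero_of_notMem_active (hx : x ∈ P.feasible ξ) (i : Fin m) (hi : i ∉ P.active x ξ) :
    P.g x ξ i < 0 :=
  (hx.2 i).lt_of_ne (mt mem_active_iff.2 hi)

namespace KKT

lemma multiplier_mul_constraint_eq_zero (h : P.KKT x l u ξ) (i : Fin m) : u i * P.g x ξ i = 0 := by
  rcases (h.mem_feasible.2 i).lt_or_eq with hi | hi
  · rw [h.compl i hi, zero_mul]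
  · rw [hi, mul_zero]

lemma multiplier_eq_zero (h : P.KKT x l u ξ) (hS : ∀ i ∉ S, P.g x ξ i < 0) (i : Fin m)
    (hi : i ∉ S) : u i = 0 :=
  h.compl i (hS i hi)

lemma isLocalMinOn (h : P.KKT x l u ξ) (hL : IsLocalMin (fun y => P.lagrangian y l u ξ) x) :
    IsLocalMinOn (fun y => P.f y ξ) (P.feasible ξ) x := by
  have hle : ∀ y ∈ P.feasible ξ, P.lagrangian y l u ξ ≤ P.f y ξ := fun y hy => by
    have hg : ∑ i, u i * P.g y ξ i ≤ 0 :=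
      Finset.sum_nonpos fun i _ => mul_nonpos_of_nonneg_of_nonpos (h.nonneg i) (hy.2 i)
    simpa [lagrangian, hy.1] using hg
  have heq : P.lagrangian x l u ξ = P.f x ξ := by
    simp [lagrangian, h.mem_feasible.1, h.multiplier_mul_constraint_eq_zero]
  filter_upwards [hL.filter_mono nhdsWithin_le_nhds, self_mem_nhdsWithin] with y hy hyf
  rw [← heq]
  exact hy.trans (hle y hyf)

end KKT

lemma kkt_iff_isPrimalDualSolution (hS : ∀ i ∉ S, P.g x ξ i < 0) :
    P.KKT x (eqMultiplier v) (ineqMultiplier v) ξ ↔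
      IsPrimalDualSolution (multiplierCone p S) (P.reducedGradL S) (P.reducedConstr S) x v ξ := by
  have hmult : ∀ i : S, ineqMultiplier v i = v (.inr i) := fun i => by simp [ineqMultiplier]
  constructor
  · intro h
    have hv : v ∈ multiplierCone p S := fun i => hmult i ▸ h.nonneg i
    refine ⟨hv, h.stationary, (mem_normalCone_multiplierCone_iff hv).2 ⟨fun j => ?_, fun i => ?_⟩⟩
    · exact congrFun (congrArg WithLp.ofLp h.mem_feasible.1) j
    · exact ⟨h.mem_feasible.2 i, hmult i ▸ h.multiplier_mul_constraint_eq_zero i⟩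
  · intro h
    obtain ⟨heq, hineq⟩ := (mem_normalCone_multiplierCone_iff h.mem).1 h.mem_normalCone
    refine ⟨⟨PiLp.ext heq, fun i => ?_⟩, fun i => ?_, h.stationary, fun i hgi => ?_⟩ <;>
      by_cases hi : i ∈ S
    · exact (hineq ⟨i, hi⟩).1
    · exact (hS i hi).le
    · exact (h.mem ⟨i, hi⟩).trans_eq (hmult ⟨i, hi⟩).symm
    · simp [ineqMultiplier, hi]
    · exact (hmult ⟨i, hi⟩).trans ((mul_eq_zero.1 (hineq ⟨i, hi⟩).2).resolve_right hgi.ne)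
    · simp [ineqMultiplier, hi]

lemma KKT.isPrimalDualSolution (h : P.KKT x l u ξ) (hS : ∀ i ∉ S, P.g x ξ i < 0) :
    IsPrimalDualSolution (multiplierCone p S) (P.reducedGradL S) (P.reducedConstr S) x
      (stackMultipliers S l u) ξ := by
  rw [← kkt_iff_isPrimalDualSolution hS, eqMultiplier_stackMultipliers,
    ineqMultiplier_stackMultipliers (h.multiplier_eq_zero hS)]
  exact h

end Reduction

section Regularity

variable {n p m r : ℕ} {P : ParamNLP n p m r} {Ξ : Set (EuclideanSpace ℝ (Fin r))}
  {S : Finset (Fin m)} {x : EuclideanSpace ℝ (Fin n)} {ξ : EuclideanSpace ℝ (Fin r)}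

lemma univ_prod_mem_nhds {X Y : Type*} [TopologicalSpace X] [TopologicalSpace Y] {T : Set Y}
    {x : X} {y : Y} (hy : y ∈ interior T) : (univ ×ˢ T : Set (X × Y)) ∈ 𝓝 (x, y) :=
  prod_mem_nhds univ_mem (mem_interior_iff_mem_nhds.1 hy)

namespace IsC2On

lemma contDiffAt_f (hC2 : P.IsC2On Ξ) (hξ : ξ ∈ interior Ξ) :
    ContDiffAt ℝ 2 (fun z : EuclideanSpace ℝ (Fin n) × EuclideanSpace ℝ (Fin r) =>
      P.f z.1 z.2) (x, ξ) :=
  hC2.f.contDiffAt (univ_prod_mem_nhds hξ)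

lemma contDiffAt_g (hC2 : P.IsC2On Ξ) (hξ : ξ ∈ interior Ξ) :
    ContDiffAt ℝ 2 (fun z : EuclideanSpace ℝ (Fin n) × EuclideanSpace ℝ (Fin r) =>
      P.g z.1 z.2) (x, ξ) :=
  hC2.g.contDiffAt (univ_prod_mem_nhds hξ)

lemma contDiffAt_reducedConstr (hC2 : P.IsC2On Ξ) (hξ : ξ ∈ interior Ξ) :
    ContDiffAt ℝ 2 (P.reducedConstr S) (x, ξ) := by
  rw [contDiffAt_euclidean]
  rintro (j | i)
  · exact contDiffAt_euclidean.1 (hC2.h.contDiffAt (univ_prod_mem_nhds hξ)) j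
  · exact contDiffAt_euclidean.1 (hC2.contDiffAt_g hξ) i

lemma contDiffAt_reducedLagrangian (hC2 : P.IsC2On Ξ) (hξ : ξ ∈ interior Ξ)
    (v : EuclideanSpace ℝ (Fin p ⊕ S)) :
    ContDiffAt ℝ 2 (fun z : (EuclideanSpace ℝ (Fin p ⊕ S) × EuclideanSpace ℝ (Fin r)) ×
      EuclideanSpace ℝ (Fin n) =>
        P.lagrangian z.2 (eqMultiplier z.1.1) (ineqMultiplier z.1.1) z.1.2) ((v, ξ), x) := by
  simp only [lagrangian_eq_add_inner_constr]
  have hproj : ContDiffAt ℝ 2 (fun z : (EuclideanSpace ℝ (Fin p ⊕ S) × EuclideanSpace ℝ (Fin r)) ×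
      EuclideanSpace ℝ (Fin n) => (z.2, z.1.2)) ((v, ξ), x) := by fun_prop
  refine ContDiffAt.add ?_ (ContDiffAt.inner ℝ (by fun_prop) ?_)
  · exact ContDiffAt.comp (g := fun z : EuclideanSpace ℝ (Fin n) × EuclideanSpace ℝ (Fin r) =>
      P.f z.1 z.2) ((v, ξ), x) (hC2.contDiffAt_f hξ) hproj
  · exact ContDiffAt.comp (g := P.reducedConstr S) ((v, ξ), x) (hC2.contDiffAt_reducedConstr hξ)
      hproj

lemma contDiffAt_lagrangian (hC2 : P.IsC2On Ξ) (hξ : ξ ∈ interior Ξ)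
    (v : EuclideanSpace ℝ (Fin p ⊕ S)) :
    ContDiffAt ℝ 2 (fun y => P.lagrangian y (eqMultiplier v) (ineqMultiplier v) ξ) x :=
  ContDiffAt.comp (f := fun y => ((v, ξ), y)) x (hC2.contDiffAt_reducedLagrangian hξ v)
    (by fun_prop)

lemma contDiffAt_reducedGradL (hC2 : P.IsC2On Ξ) (hξ : ξ ∈ interior Ξ)
    (v : EuclideanSpace ℝ (Fin p ⊕ S)) : ContDiffAt ℝ 1 (P.reducedGradL S) ((v, ξ), x) :=
  contDiffAt_gradient_snd (hC2.contDiffAt_reducedLagrangian hξ v)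

lemma hasStrictFDerivAt_reducedConstr (hC2 : P.IsC2On Ξ) (hξ : ξ ∈ interior Ξ) :
    HasStrictFDerivAt (P.reducedConstr S) ((fderiv ℝ (fun y => P.constr S y ξ) x).coprod
      (fderiv ℝ (fun ζ => P.constr S x ζ) ξ)) (x, ξ) :=
  hasStrictFDerivAt_coprod_fderiv
    ((hC2.contDiffAt_reducedConstr hξ).hasStrictFDerivAt (by norm_num))

lemma hasFDerivAt_constr (hC2 : P.IsC2On Ξ) (hξ : ξ ∈ interior Ξ) :
    HasFDerivAt (fun y => P.constr S y ξ) (fderiv ℝ (fun y => P.constr S y ξ) x) x :=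
  (DifferentiableAt.comp (g := P.reducedConstr S) (f := fun y => (y, ξ)) x
    (hC2.hasStrictFDerivAt_reducedConstr hξ).differentiableAt (by fun_prop)).hasFDerivAt

lemma reducedGradL_eq_add_adjoint (hC2 : P.IsC2On Ξ) (hξ : ξ ∈ interior Ξ)
    (v : EuclideanSpace ℝ (Fin p ⊕ S)) :
    P.reducedGradL S ((v, ξ), x) = gradient (fun y => P.f y ξ) x +
      adjoint (fderiv ℝ (fun y => P.constr S y ξ) x) v := by
  have hf : DifferentiableAt ℝ (fun y => P.f y ξ) x :=
    DifferentiableAt.comp (f := fun y => (y, ξ)) x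
      ((hC2.contDiffAt_f hξ).differentiableAt (by norm_num)) (by fun_prop)
  have hsum := hf.hasGradientAt.hasFDerivAt.add
    (hasGradientAt_inner_left_const (hC2.hasFDerivAt_constr (S := S) (x := x) hξ) v).hasFDerivAt
  rw [← map_add] at hsum
  simp only [reducedGradL, gradL, lagrangian_eq_add_inner_constr]
  exact (hasGradientAt_iff_hasFDerivAt.2 hsum).gradient

lemma hasStrictFDerivAt_reducedGradL (hC2 : P.IsC2On Ξ) (hξ : ξ ∈ interior Ξ)
    (v : EuclideanSpace ℝ (Fin p ⊕ S)) :
    HasStrictFDerivAt (P.reducedGradL S)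
      (((adjoint (fderiv ℝ (fun y => P.constr S y ξ) x)).coprod
        (P.mixedL x (eqMultiplier v) (ineqMultiplier v) ξ)).coprod
          (P.hessL x (eqMultiplier v) (ineqMultiplier v) ξ)) ((v, ξ), x) := by
  have hstrict := (hC2.contDiffAt_reducedGradL (x := x) hξ v).hasStrictFDerivAt (by norm_num)
  have hdata : HasStrictFDerivAt (fun w => P.reducedGradL S (w, x)) _ (v, ξ) :=
    ((hC2.contDiffAt_reducedGradL (x := x) hξ v).comp (f := fun w => (w, x)) (v, ξ)
      (by fun_prop)).hasStrictFDerivAt (by norm_num)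
  have hmultiplier : HasFDerivAt (fun w => P.reducedGradL S ((w, ξ), x))
      (adjoint (fderiv ℝ (fun y => P.constr S y ξ) x)) v := by
    simp only [hC2.reducedGradL_eq_add_adjoint hξ]
    exact (ContinuousLinearMap.hasFDerivAt _).const_add _
  have hpartial := (hasStrictFDerivAt_coprod_fderiv hdata).hasFDerivAt.fderiv
  rw [hmultiplier.fderiv] at hpartial
  have htotal := hasStrictFDerivAt_coprod_fderiv hstrict
  rwa [hpartial] at htotal

lemma isSymmetric_hessL (hC2 : P.IsC2On Ξ) (hξ : ξ ∈ interior Ξ)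
    (v : EuclideanSpace ℝ (Fin p ⊕ S)) :
    (P.hessL x (eqMultiplier v) (ineqMultiplier v) ξ).toLinearMap.IsSymmetric :=
  isSymmetric_fderiv_gradient (hC2.contDiffAt_lagrangian hξ v)

lemma gradient_constr_apply (hC2 : P.IsC2On Ξ) (hξ : ξ ∈ interior Ξ) (k : Fin p ⊕ S) :
    gradient (fun y => P.constr S y ξ k) x =
      adjoint (fderiv ℝ (fun y => P.constr S y ξ) x) (EuclideanSpace.single k 1) := by
  have hgrad := hasGradientAt_inner_left_const (hC2.hasFDerivAt_constr (S := S) (x := x) hξ)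
    (EuclideanSpace.single k 1)
  simp only [EuclideanSpace.inner_single_left, map_one, one_mul] at hgrad
  exact hgrad.gradient

lemma linearIndependent_gradient_constr_iff (hC2 : P.IsC2On Ξ) (hξ : ξ ∈ interior Ξ) :
    LinearIndependent ℝ (fun k : Fin p ⊕ S => gradient (fun y => P.constr S y ξ k) x) ↔
      Function.Injective (adjoint (fderiv ℝ (fun y => P.constr S y ξ) x)) := by
  simp only [hC2.gradient_constr_apply hξ]
  exact linearIndependent_apply_single_iff
    (adjoint (fderiv ℝ (fun y => P.constr S y ξ) x)).toLinearMap

lemma licq_of_injective (hC2 : P.IsC2On Ξ) (hξ : ξ ∈ interior Ξ) (hS : ∀ i ∉ S, P.g x ξ i < 0)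
    (hinj : Function.Injective (adjoint (fderiv ℝ (fun y => P.constr S y ξ) x))) :
    P.LICQ x ξ := by
  have hsub : ∀ i ∈ P.active x ξ, i ∈ S := fun i hi => by
    by_contra hiS
    exact (hS i hiS).ne (mem_active_iff.1 hi)
  have hindep := ((hC2.linearIndependent_gradient_constr_iff hξ).2 hinj).comp
    (Sum.map id (Subtype.map id hsub))
    (Function.injective_id.sumMap (Subtype.map_injective hsub Function.injective_id))
  rw [LICQ]
  convert hindep using 1
  funext k
  rcases k with j | i <;> rfl

lemma eventually_inactive (hC2 : P.IsC2On Ξ) (hξ : ξ ∈ interior Ξ) (hS : ∀ i ∉ S, P.g x ξ i < 0) :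
    ∀ᶠ z : EuclideanSpace ℝ (Fin n) × EuclideanSpace ℝ (Fin r) in 𝓝 (x, ξ),
      ∀ i ∉ S, P.g z.1 z.2 i < 0 := by
  refine eventually_all.2 fun i => eventually_imp_distrib_left.2 fun hi => ?_
  exact (contDiffAt_euclidean.1 (hC2.contDiffAt_g hξ) i).continuousAt.eventually_lt_const (hS i hi)

lemma eventually_adjoint_injective (hC2 : P.IsC2On Ξ) (hξ : ξ ∈ interior Ξ)
    (hinj : Function.Injective (adjoint (fderiv ℝ (fun y => P.constr S y ξ) x))) :
    ∀ᶠ z : EuclideanSpace ℝ (Fin n) × EuclideanSpace ℝ (Fin r) in 𝓝 (x, ξ),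
      Function.Injective (adjoint (fderiv ℝ (fun y => P.constr S y z.2) z.1)) := by
  have hfderiv : ContDiffAt ℝ 0
      (fun z : EuclideanSpace ℝ (Fin n) × EuclideanSpace ℝ (Fin r) =>
        fderiv ℝ (fun y => P.constr S y z.2) z.1) (x, ξ) :=
    ContDiffAt.fderiv
      (f := fun (z : EuclideanSpace ℝ (Fin n) × EuclideanSpace ℝ (Fin r)) y => P.constr S y z.2)
      (ContDiffAt.comp (g := P.reducedConstr S) (f := fun w : (EuclideanSpace ℝ (Fin n) ×
        EuclideanSpace ℝ (Fin r)) × EuclideanSpace ℝ (Fin n) => (w.2, w.1.2)) ((x, ξ), x)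
          (hC2.contDiffAt_reducedConstr hξ) (by fun_prop)) contDiffAt_fst (by norm_num)
  exact (adjoint.continuous.continuousAt.comp hfderiv.continuousAt).eventually
    (ContinuousLinearMap.isOpen_injective.mem_nhds hinj)

lemma eventually_hessL_coercive (hC2 : P.IsC2On Ξ) (hξ : ξ ∈ interior Ξ)
    {v : EuclideanSpace ℝ (Fin p ⊕ S)} {a a' : ℝ} (haa' : a' < a)
    (hA : ∀ y, a * ‖y‖ ^ 2 ≤ ⟪y, P.hessL x (eqMultiplier v) (ineqMultiplier v) ξ y⟫_ℝ) :
    ∀ᶠ z : (EuclideanSpace ℝ (Fin p ⊕ S) × EuclideanSpace ℝ (Fin r)) × EuclideanSpace ℝ (Fin n)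
      in 𝓝 ((v, ξ), x), ∀ y, a' * ‖y‖ ^ 2 ≤
        ⟪y, P.hessL z.2 (eqMultiplier z.1.1) (ineqMultiplier z.1.1) z.1.2 y⟫_ℝ := by
  have hfderiv : ContDiffAt ℝ 0 (fun z : (EuclideanSpace ℝ (Fin p ⊕ S) ×
      EuclideanSpace ℝ (Fin r)) × EuclideanSpace ℝ (Fin n) =>
        P.hessL z.2 (eqMultiplier z.1.1) (ineqMultiplier z.1.1) z.1.2) ((v, ξ), x) :=
    ContDiffAt.fderiv (f := fun (z : (EuclideanSpace ℝ (Fin p ⊕ S) × EuclideanSpace ℝ (Fin r)) ×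
      EuclideanSpace ℝ (Fin n)) y => P.reducedGradL S (z.1, y))
      (ContDiffAt.comp (((v, ξ), x), x) (hC2.contDiffAt_reducedGradL hξ v)
        (contDiffAt_fst.fst'.prodMk contDiffAt_snd)) contDiffAt_snd (by norm_num)
  exact hfderiv.continuousAt.eventually (eventually_coercive haa' hA)

end IsC2On

end Regularity

section Constants

variable {n p m r : ℕ} {P : ParamNLP n p m r} {x : EuclideanSpace ℝ (Fin n)}
  {l : EuclideanSpace ℝ (Fin p)} {u : EuclideanSpace ℝ (Fin m)} {ξ : EuclideanSpace ℝ (Fin r)}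
  {ℓ₁ ℓ₂ : ℝ}

lemma div_mul_le_rpow_div_mul {a b σ t : ℝ} (ha : 0 < a) (hab : a ≤ b) (hσ : 0 < σ)
    (ht : 0 ≤ t) :
    b / σ * t ≤ b ^ (3 / 2 : ℝ) / (σ * a ^ (1 / 2 : ℝ)) * t := by
  have hb := ha.trans_le hab
  have hpow : b * a ^ (1 / 2 : ℝ) ≤ b ^ (3 / 2 : ℝ) :=
    calc b * a ^ (1 / 2 : ℝ) ≤ b ^ (1 : ℝ) * b ^ (1 / 2 : ℝ) := by rw [Real.rpow_one]; gcongr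
      _ = b ^ (3 / 2 : ℝ) := by rw [← Real.rpow_add hb]; norm_num
  refine mul_le_mul_of_nonneg_right ?_ ht
  rw [div_le_div_iff₀ hσ (by positivity)]
  calc b * (σ * a ^ (1 / 2 : ℝ)) = b * a ^ (1 / 2 : ℝ) * σ := by ring
    _ ≤ b ^ (3 / 2 : ℝ) * σ := by gcongr

lemma exists_hasSaddleBounds_of_nonempty [Nonempty (Fin p ⊕ P.active x ξ)]
    (hsymm : (P.hessL x l u ξ).toLinearMap.IsSymmetric)
    (hpos : ∀ y, y ≠ 0 → 0 < ⟪y, P.hessL x l u ξ y⟫_ℝ)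
    (hinj : Function.Injective (adjoint (P.jacX x ξ)))
    (hℓ₁ : P.ellPrimal x l u ξ < ℓ₁) (hℓ₂ : P.ellDual x l u ξ < ℓ₂) :
    ∃ a b σ, HasSaddleBounds (P.hessL x l u ξ) (P.jacX x ξ) a b σ ∧
      √(b / a) * (‖P.mixedL x l u ξ‖ / a + ‖P.jacXi x ξ‖ / σ) < ℓ₁ ∧
      b / σ * (‖P.mixedL x l u ξ‖ / a + ‖P.jacXi x ξ‖ / σ) < ℓ₂ := by
  have : Nontrivial (EuclideanSpace ℝ (Fin n)) := hinj.nontrivial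
  have hbounds := hasSaddleBounds_lamMin_lamMax hsymm hpos (sigmaMin_pos hinj)
    (sigmaMin_mul_norm_le hinj)
  rw [ellDual, if_neg (not_isEmpty_of_nonempty _)] at hℓ₂
  refine ⟨_, _, _, hbounds, hℓ₁, hℓ₂.trans_le' ?_⟩
  exact div_mul_le_rpow_div_mul hbounds.lower_pos hbounds.lower_le_upper hbounds.adjoint_pos
    (add_nonneg (div_nonneg (norm_nonneg _) hbounds.lower_pos.le)
      (div_nonneg (norm_nonneg _) hbounds.adjoint_pos.le))

/-- Without constraints, any `σ > 0` is a lower bound for `adjoint B`; a large one makes the dual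
constant small. -/
lemma exists_hasSaddleBounds_of_isEmpty [IsEmpty (Fin p ⊕ P.active x ξ)]
    (hsymm : (P.hessL x l u ξ).toLinearMap.IsSymmetric)
    (hpos : ∀ y, y ≠ 0 → 0 < ⟪y, P.hessL x l u ξ y⟫_ℝ)
    (hℓ₁ : P.ellPrimal x l u ξ < ℓ₁) (hℓ₂ : P.ellDual x l u ξ < ℓ₂) :
    ∃ a b σ, HasSaddleBounds (P.hessL x l u ξ) (P.jacX x ξ) a b σ ∧
      √(b / a) * (‖P.mixedL x l u ξ‖ / a + ‖P.jacXi x ξ‖ / σ) < ℓ₁ ∧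
      b / σ * (‖P.mixedL x l u ξ‖ / a + ‖P.jacXi x ξ‖ / σ) < ℓ₂ := by
  rw [ellDual, if_pos ‹_›] at hℓ₂
  have hG : P.jacXi x ξ = 0 := ContinuousLinearMap.ext fun _ => Subsingleton.elim _ _
  simp only [ellPrimal, ellBase, hG, norm_zero, zero_div, add_zero] at hℓ₁ ⊢
  rcases subsingleton_or_nontrivial (EuclideanSpace ℝ (Fin n)) with hn | hn
  · have hL : P.mixedL x l u ξ = 0 := ContinuousLinearMap.ext fun _ => Subsingleton.elim _ _
    simp only [hL, norm_zero, zero_div, mul_zero] at hℓ₁ ⊢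
    refine ⟨1, 1, 1, ⟨hsymm, one_pos, le_rfl, fun y => ?_, fun y => ?_, one_pos, fun v => ?_⟩,
      hℓ₁, hℓ₂⟩
    · simp [Subsingleton.elim y 0]
    · simp [Subsingleton.elim y 0]
    · simp [Subsingleton.elim v 0]
  · obtain ⟨σ, hσ, hlarge⟩ := exists_pos_lt_mul hℓ₂
      (lamMax (P.hessL x l u ξ) * (‖P.mixedL x l u ξ‖ / lamMin (P.hessL x l u ξ)))
    refine ⟨_, _, σ, hasSaddleBounds_lamMin_lamMax hsymm hpos hσ fun v => ?_, hℓ₁, ?_⟩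
    · simp [Subsingleton.elim v 0]
    · rwa [div_mul_eq_mul_div, div_lt_iff₀' hσ]

theorem exists_hasSaddleBounds (hsymm : (P.hessL x l u ξ).toLinearMap.IsSymmetric)
    (hpos : ∀ y, y ≠ 0 → 0 < ⟪y, P.hessL x l u ξ y⟫_ℝ)
    (hinj : Function.Injective (adjoint (P.jacX x ξ)))
    (hℓ₁ : P.ellPrimal x l u ξ < ℓ₁) (hℓ₂ : P.ellDual x l u ξ < ℓ₂) :
    ∃ a b σ, HasSaddleBounds (P.hessL x l u ξ) (P.jacX x ξ) a b σ ∧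
      √(b / a) * (‖P.mixedL x l u ξ‖ / a + ‖P.jacXi x ξ‖ / σ) < ℓ₁ ∧
      b / σ * (‖P.mixedL x l u ξ‖ / a + ‖P.jacXi x ξ‖ / σ) < ℓ₂ := by
  cases isEmpty_or_nonempty (Fin p ⊕ P.active x ξ)
  · exact exists_hasSaddleBounds_of_isEmpty hsymm hpos hℓ₁ hℓ₂
  · exact exists_hasSaddleBounds_of_nonempty hsymm hpos hinj hℓ₁ hℓ₂

end Constants

section SolutionMaps

variable {n p m r : ℕ} {P : ParamNLP n p m r} {Ξ : Set (EuclideanSpace ℝ (Fin r))}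
  {S : Finset (Fin m)} {x₀ : EuclideanSpace ℝ (Fin n)} {v₀ : EuclideanSpace ℝ (Fin p ⊕ S)}
  {ξ₀ : EuclideanSpace ℝ (Fin r)} {a b σ : ℝ}

namespace IsC2On

lemma eventually_isRegularMinimizer (hC2 : P.IsC2On Ξ) (hξ₀ : ξ₀ ∈ interior Ξ)
    (hS : ∀ i ∉ S, P.g x₀ ξ₀ i < 0)
    (hinj : Function.Injective (adjoint (fderiv ℝ (fun y => P.constr S y ξ₀) x₀))) (ha : 0 < a)
    (hA : ∀ y, a * ‖y‖ ^ 2 ≤ ⟪y, P.hessL x₀ (eqMultiplier v₀) (ineqMultiplier v₀) ξ₀ y⟫_ℝ) :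
    ∀ᶠ z : (EuclideanSpace ℝ (Fin p ⊕ S) × EuclideanSpace ℝ (Fin r)) × EuclideanSpace ℝ (Fin n)
      in 𝓝 ((v₀, ξ₀), x₀),
        IsPrimalDualSolution (multiplierCone p S) (P.reducedGradL S) (P.reducedConstr S)
          z.2 z.1.1 z.1.2 →
        P.IsRegularMinimizer z.2 (eqMultiplier z.1.1) (ineqMultiplier z.1.1) z.1.2 ∧
          IsLocalMinOn (fun x => P.f x z.1.2) (P.feasible z.1.2) z.2 := by
  have hproj : Tendsto (fun z : (EuclideanSpace ℝ (Fin p ⊕ S) × EuclideanSpace ℝ (Fin r)) ×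
      EuclideanSpace ℝ (Fin n) => (z.2, z.1.2)) (𝓝 ((v₀, ξ₀), x₀)) (𝓝 (x₀, ξ₀)) :=
    Continuous.tendsto' (by fun_prop) _ _ rfl
  have hinterior : ∀ᶠ z : EuclideanSpace ℝ (Fin n) × EuclideanSpace ℝ (Fin r) in 𝓝 (x₀, ξ₀),
      z.2 ∈ interior Ξ := continuousAt_snd (isOpen_interior.mem_nhds hξ₀)
  filter_upwards [hproj.eventually hinterior, hproj.eventually (hC2.eventually_inactive hξ₀ hS),
    hproj.eventually (hC2.eventually_adjoint_injective hξ₀ hinj),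
    hC2.eventually_hessL_coercive hξ₀ (half_lt_self ha) hA] with z hξ hinactive hinj hcoercive hsol
  have hkkt := (kkt_iff_isPrimalDualSolution hinactive).2 hsol
  refine ⟨⟨hC2.licq_of_injective hξ hinactive hinj, hkkt, fun y hy _ _ => ?_⟩,
    hkkt.isLocalMinOn (isLocalMin_of_gradient_eq_zero (hC2.contDiffAt_lagrangian hξ _)
      hkkt.stationary (half_pos ha) hcoercive)⟩
  have := norm_pos_iff.2 hy
  exact (by positivity : 0 < a / 2 * ‖y‖ ^ 2).trans_le (hcoercive y)

theorem exists_isSolutionMap (hC2 : P.IsC2On Ξ) (hξ₀ : ξ₀ ∈ interior Ξ)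
    (hS : ∀ i ∉ S, P.g x₀ ξ₀ i < 0)
    (hkkt : P.KKT x₀ (eqMultiplier v₀) (ineqMultiplier v₀) ξ₀)
    (hbounds : HasSaddleBounds (P.hessL x₀ (eqMultiplier v₀) (ineqMultiplier v₀) ξ₀)
      (fderiv ℝ (fun y => P.constr S y ξ₀) x₀) a b σ) :
    ∃ N xs ls us,
      P.IsSolutionMap Ξ x₀ (eqMultiplier v₀) (ineqMultiplier v₀) ξ₀ N xs ls us := by
  obtain ⟨N, hN, xs, vs, hxs, hvs, hx₀, hv₀, hsol⟩ :=
    hbounds.exists_continuousOn_isPrimalDualSolution isClosed_multiplierCone convex_multiplierCone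
      (hC2.hasStrictFDerivAt_reducedGradL hξ₀ v₀) (hC2.hasStrictFDerivAt_reducedConstr hξ₀)
      ((kkt_iff_isPrimalDualSolution hS).1 hkkt)
      (hC2.eventually_isRegularMinimizer hξ₀ hS hbounds.adjoint_injective hbounds.lower_pos
        hbounds.lower)
  exact ⟨N ∩ interior Ξ, xs, fun ξ => eqMultiplier (vs ξ), fun ξ => ineqMultiplier (vs ξ),
    { mem_nhds := inter_mem hN (isOpen_interior.mem_nhds hξ₀)
      subset := fun ξ hξ => interior_subset hξ.2
      continuousOn_x := hxs.mono inter_subset_left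
      continuousOn_l := continuous_eqMultiplier.comp_continuousOn (hvs.mono inter_subset_left)
      continuousOn_u := continuous_ineqMultiplier.comp_continuousOn (hvs.mono inter_subset_left)
      base_x := hx₀
      base_l := congrArg eqMultiplier hv₀
      base_u := congrArg ineqMultiplier hv₀
      regular := fun ξ hξ => ((hsol ξ hξ.1).1 (hsol ξ hξ.1).2).1
      isLocalMin := fun ξ hξ => ((hsol ξ hξ.1).1 (hsol ξ hξ.1).2).2 }⟩

variable {N : Set (EuclideanSpace ℝ (Fin r))}
  {xs : EuclideanSpace ℝ (Fin r) → EuclideanSpace ℝ (Fin n)}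
  {ls : EuclideanSpace ℝ (Fin r) → EuclideanSpace ℝ (Fin p)}
  {us : EuclideanSpace ℝ (Fin r) → EuclideanSpace ℝ (Fin m)} {ℓ₁ ℓ₂ : ℝ}

theorem exists_nhdsWithin_norm_sub_le_of_isSolutionMap (hC2 : P.IsC2On Ξ) (hξ₀ : ξ₀ ∈ interior Ξ)
    (hS : ∀ i ∉ S, P.g x₀ ξ₀ i < 0)
    (hbounds : HasSaddleBounds (P.hessL x₀ (eqMultiplier v₀) (ineqMultiplier v₀) ξ₀)
      (fderiv ℝ (fun y => P.constr S y ξ₀) x₀) a b σ)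
    (hℓ₁ : √(b / a) * (‖P.mixedL x₀ (eqMultiplier v₀) (ineqMultiplier v₀) ξ₀‖ / a +
      ‖fderiv ℝ (fun ζ => P.constr S x₀ ζ) ξ₀‖ / σ) < ℓ₁)
    (hℓ₂ : b / σ * (‖P.mixedL x₀ (eqMultiplier v₀) (ineqMultiplier v₀) ξ₀‖ / a +
      ‖fderiv ℝ (fun ζ => P.constr S x₀ ζ) ξ₀‖ / σ) < ℓ₂)
    (hs : P.IsSolutionMap Ξ x₀ (eqMultiplier v₀) (ineqMultiplier v₀) ξ₀ N xs ls us) :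
    ∃ U ∈ 𝓝[N] ξ₀, U ⊆ N ∧ ∀ y ∈ U, ∀ z ∈ U, ‖xs y - xs z‖ ≤ ℓ₁ * ‖y - z‖ ∧
      ‖WithLp.toLp 2 (ls y, us y) - WithLp.toLp 2 (ls z, us z)‖ ≤ ℓ₂ * ‖y - z‖ := by
  obtain ⟨W, hW, hlip⟩ := hbounds.exists_nhds_forall_norm_sub_le (K := multiplierCone p S)
    (hC2.hasStrictFDerivAt_reducedGradL hξ₀ v₀) (hC2.hasStrictFDerivAt_reducedConstr hξ₀) hℓ₁ hℓ₂
  have hx : Tendsto xs (𝓝 ξ₀) (𝓝 x₀) :=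
    hs.base_x ▸ hs.continuousOn_x.continuousAt hs.mem_nhds
  have hv : Tendsto (fun ξ => stackMultipliers S (ls ξ) (us ξ)) (𝓝 ξ₀) (𝓝 v₀) := by
    have hcont := (continuous_stackMultipliers (S := S)).continuousAt.comp
      ((hs.continuousOn_l.continuousAt hs.mem_nhds).prodMk
        (hs.continuousOn_u.continuousAt hs.mem_nhds))
    simpa only [ContinuousAt, Function.comp_def, hs.base_l, hs.base_u,
      stackMultipliers_eqMultiplier_ineqMultiplier] using hcont
  have hmem : ∀ᶠ ξ in 𝓝 ξ₀, ((stackMultipliers S (ls ξ) (us ξ), ξ), xs ξ) ∈ W :=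
    ((hv.prodMk_nhds tendsto_id).prodMk_nhds hx) hW
  have hinactive : ∀ᶠ ξ in 𝓝 ξ₀, ∀ i ∉ S, P.g (xs ξ) ξ i < 0 :=
    (hx.prodMk_nhds tendsto_id).eventually (hC2.eventually_inactive hξ₀ hS)
  refine ⟨_, inter_mem self_mem_nhdsWithin (mem_nhdsWithin_of_mem_nhds (hmem.and hinactive)),
    inter_subset_left, ?_⟩
  rintro y ⟨hyN, hyW, hyS⟩ z ⟨hzN, hzW, hzS⟩
  have hy := (hs.regular y hyN).kkt
  have hz := (hs.regular z hzN).kkt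
  rw [norm_toLp_sub_eq_norm_stackMultipliers_sub (hy.multiplier_eq_zero hyS)
    (hz.multiplier_eq_zero hzS)]
  exact hlip _ _ _ _ _ _ hyW hzW (hy.isPrimalDualSolution hyS) (hz.isPrimalDualSolution hzS)

end IsC2On

end SolutionMaps

end ParamNLP

theorem mainTheorem1 {n p m r : ℕ} (P : ParamNLP n p m r)
    (Ξ : Set (EuclideanSpace ℝ (Fin r))) (hC2 : P.IsC2On Ξ)
    (x₀ : EuclideanSpace ℝ (Fin n)) (l₀ : EuclideanSpace ℝ (Fin p))
    (u₀ : EuclideanSpace ℝ (Fin m)) (ξ₀ : EuclideanSpace ℝ (Fin r))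
    (hξ₀ : ξ₀ ∈ interior Ξ)
    (hreg : P.IsRegularMinimizer x₀ l₀ u₀ ξ₀)
    (hA : ∀ y : EuclideanSpace ℝ (Fin n), y ≠ 0 → 0 < inner ℝ y (P.hessL x₀ l₀ u₀ ξ₀ y)) :
    (∃ (N : Set (EuclideanSpace ℝ (Fin r)))
      (xs : EuclideanSpace ℝ (Fin r) → EuclideanSpace ℝ (Fin n))
      (ls : EuclideanSpace ℝ (Fin r) → EuclideanSpace ℝ (Fin p))
      (us : EuclideanSpace ℝ (Fin r) → EuclideanSpace ℝ (Fin m)),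
      P.IsSolutionMap Ξ x₀ l₀ u₀ ξ₀ N xs ls us) ∧
    ∀ (N : Set (EuclideanSpace ℝ (Fin r)))
      (xs : EuclideanSpace ℝ (Fin r) → EuclideanSpace ℝ (Fin n))
      (ls : EuclideanSpace ℝ (Fin r) → EuclideanSpace ℝ (Fin p))
      (us : EuclideanSpace ℝ (Fin r) → EuclideanSpace ℝ (Fin m)),
      P.IsSolutionMap Ξ x₀ l₀ u₀ ξ₀ N xs ls us →
        LocallyLipschitzAtWith (P.ellPrimal x₀ l₀ u₀ ξ₀) xs N ξ₀ ∧
        LocallyLipschitzAtWith (P.ellDual x₀ l₀ u₀ ξ₀)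
          (fun ξ => WithLp.toLp 2 (ls ξ, us ξ)) N ξ₀ := by
  have hS := ParamNLP.lt_zero_of_notMem_active hreg.kkt.mem_feasible
  have hinj := (hC2.linearIndependent_gradient_constr_iff hξ₀).1 hreg.licq
  obtain ⟨v₀, rfl, rfl⟩ : ∃ v₀ : EuclideanSpace ℝ (Fin p ⊕ P.active x₀ ξ₀),
      ParamNLP.eqMultiplier v₀ = l₀ ∧ ParamNLP.ineqMultiplier v₀ = u₀ :=
    ⟨_, ParamNLP.eqMultiplier_stackMultipliers l₀ u₀,
      ParamNLP.ineqMultiplier_stackMultipliers (hreg.kkt.multiplier_eq_zero hS)⟩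
  have hbounds {ℓ₁ ℓ₂ : ℝ} := ParamNLP.exists_hasSaddleBounds (ℓ₁ := ℓ₁) (ℓ₂ := ℓ₂)
    (hC2.isSymmetric_hessL hξ₀ v₀) hA hinj
  constructor
  · obtain ⟨a, b, σ, hsaddle, -⟩ := hbounds (lt_add_one _) (lt_add_one _)
    exact hC2.exists_isSolutionMap hξ₀ hS hreg.kkt hsaddle
  · refine fun N xs ls us hs => ⟨fun ℓ hℓ => ?_, fun ℓ hℓ => ?_⟩
    · obtain ⟨a, b, σ, hsaddle, hℓ₁, hℓ₂⟩ := hbounds hℓ (lt_add_one _)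
      obtain ⟨U, hU, hUN, hlip⟩ := hC2.exists_nhdsWithin_norm_sub_le_of_isSolutionMap hξ₀ hS
        hsaddle hℓ₁ hℓ₂ hs
      exact ⟨U, hU, hUN, fun y hy z hz => (hlip y hy z hz).1⟩
    · obtain ⟨a, b, σ, hsaddle, hℓ₁, hℓ₂⟩ := hbounds (lt_add_one _) hℓ
      obtain ⟨U, hU, hUN, hlip⟩ := hC2.exists_nhdsWithin_norm_sub_le_of_isSolutionMap hξ₀ hS
        hsaddle hℓ₁ hℓ₂ hs
      exact ⟨U, hU, hUN, fun y hy z hz => (hlip y hy z hz).2⟩
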